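/- For a lattice $L$, let $\mathrm{Con}\,L$ be the lattice of all congruences of $L$ under inclusion, and let $\mathrm{Con}_c L$ be the $(\vee,0)$-semilattice of all finitely generated congruences of $L$, that is, of all finite joins of principal congruences $\Theta_L(x,y)$ (the least congruence identifying $x$ with $y$), $x,y\in L$. For a $(\vee,0)$-semilattice $S$, call a finite set $\mathbf{x}$ of triples $(u,v,w)\in S^3$ with $w\le u\vee v$ *reduced* if (1) $\mathbf{x}$ contains exactly one triple of the form $(p,p,p)$, and one puts $\pi(\mathbf{x})=p$; (2) $(u,v,w)\in\mathbf{x}$ and $(v,u,w)\in\mathbf{x}$ imply $u=v=w$; (3) if $(u,v,w)\in\mathbf{x}$ is different from $(\pi(\mathbf{x}),\pi(\mathbf{x}),\pi(\mathbf{x}))$, then none of $u,v,w$ is $\le\pi(\mathbf{x})$. Let $\mathcal{R}(S)$ be the set of all reduced sets, ordered by: $\mathbf{x}\le\mathbf{y}$ if and only if for all $(u,v,w)\in\mathbf{x}\setminus\mathbf{y}$, either $u\le\pi(\mathbf{y})$ or $w\le\pi(\mathbf{y})$. This is a $(\vee,0)$-semilattice, which contains $S$ via the $(\vee,0)$-embedding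 $a\mapsto\{(a,a,a)\}$. Let $\mathcal{D}(S)=\bigcup_{n<\omega}\mathcal{R}^n(S)$ be the increasing union of the iterates of $\mathcal{R}$, starting with $\mathcal{R}^0(S)=S$. For a set $\Omega$, let $\mathcal{L}(\Omega)$ be the $(\vee,0)$-semilattice defined by generators $1$, $a_0^\xi$, $a_1^\xi$ ($\xi\in\Omega$) and relations $a_0^\xi\vee a_1^\xi=1$ ($\xi\in\Omega$), and put $\mathcal{G}(\Omega)=\mathcal{D}(\mathcal{L}(\Omega))$. **Theorem.** Let $\Omega$ be a set with $|\Omega|\ge\aleph_{\omega+1}$. Then there is no lattice $L$ with $\mathrm{Con}_c L\cong\mathcal{G}(\Omega)$. Moreover, the ideal lattice of $\mathcal{G}(\Omega)$ is an algebraic distributive lattice whose top element is compact and which has exactly $|\Omega|$ compact elements, and it is not isomorphic to $\mathrm{Con}\,L$ for any lattice $L$. Consequently (take $|\Omega|=\aleph_{\omega+1}$), there is an algebraic distributive lattice with compact top element and exactly $\aleph_{\omega+1}$ compact elements that is not isomorphic to the congruence lattice of any lattice; this answers Dilworth's Congruence Lattice Problem in the negative. -/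

import Mathlib

open Cardinal Ordinal

universe u v

/-! ### The congruence lattice of a lattice -/

namespace LatticeCon

section

variable {L : Type u} [Lattice L]

theorem toSetoid_inj : Function.Injective (LatticeCon.toSetoid : LatticeCon L → Setoid L) := by
  rintro ⟨r, _, _⟩ ⟨s, _, _⟩ h
  cases h
  rfl

/-- Congruences are ordered by inclusion. -/
instance : PartialOrder (LatticeCon L) := PartialOrder.lift LatticeCon.toSetoid toSetoid_inj

theorem le_iff {c d : LatticeCon L} : c ≤ d ↔ ∀ x y, c.r x y → d.r x y := Iff.rfl

/-- The intersection of a set of congruences. -/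
instance : InfSet (LatticeCon L) where
  sInf C :=
    { r := fun x y => ∀ c ∈ C, c.r x y
      iseqv :=
        { refl := fun x c _ => c.iseqv.refl x
          symm := fun h c hc => c.iseqv.symm (h c hc)
          trans := fun h k c hc => c.iseqv.trans (h c hc) (k c hc) }
      inf := fun h k c hc => c.inf (h c hc) (k c hc)
      sup := fun h k c hc => c.sup (h c hc) (k c hc) }

/-- The congruence lattice `Con L`. -/
instance : CompleteLattice (LatticeCon L) :=
  completeLatticeOfInf (LatticeCon L) fun _ =>
    ⟨fun _ hc => le_iff.2 fun _ _ h => h _ hc,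
      fun _ hd => le_iff.2 fun x y h _ hc => le_iff.1 (hd hc) x y h⟩

/-- `Θ(x, y)`: the least congruence that identifies `x` with `y`. -/
def principal (x y : L) : LatticeCon L := sInf {c | c.r x y}

/-- A congruence is finitely generated if it is a finite (possibly empty) join of principal
congruences. -/
def IsFinitelyGenerated (c : LatticeCon L) : Prop :=
  ∃ F : Finset (L × L), c = F.sup fun p => principal p.1 p.2

theorem isFinitelyGenerated_bot : IsFinitelyGenerated (⊥ : LatticeCon L) :=
  ⟨∅, Finset.sup_empty.symm⟩

theorem IsFinitelyGenerated.sup_mem {c d : LatticeCon L} (hc : IsFinitelyGenerated c)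
    (hd : IsFinitelyGenerated d) : IsFinitelyGenerated (c ⊔ d) := by
  classical
  obtain ⟨F, rfl⟩ := hc
  obtain ⟨G, rfl⟩ := hd
  exact ⟨F ∪ G, Finset.sup_union.symm⟩

end

end LatticeCon

/-- `Con_c L`: the join-semilattice with zero of all finitely generated congruences of the
lattice `L`, ordered by inclusion. -/
abbrev FGCon (L : Type u) [Lattice L] : Type u :=
  {c : LatticeCon L // c.IsFinitelyGenerated}

instance (L : Type u) [Lattice L] : SemilatticeSup (FGCon L) :=
  Subtype.semilatticeSup fun _ _ hc hd => hc.sup_mem hd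

instance (L : Type u) [Lattice L] : OrderBot (FGCon L) :=
  Subtype.orderBot LatticeCon.isFinitelyGenerated_bot

/-! ### The free distributive extension of a join-semilattice with zero -/

/-- The reduced subsets of `C(S) = {(u, v, w) | w ≤ u ⊔ v}`: finite sets of such triples that
contain exactly one diagonal triple `(π, π, π)`, contain no two mirror triples `(u, v, w)`,
`(v, u, w)` unless `u = v = w`, and in which no entry of a triple other than `(π, π, π)` lies
below `π`. The element `π`, which is determined by the set, is recorded as `proj`. -/
structure FreeDistExt (S : Type u) [SemilatticeSup S] : Type u where
  carrier : Finset (S × S × S)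
  proj : S
  le_sup : ∀ u v w, (u, v, w) ∈ carrier → w ≤ u ⊔ v
  diag_mem_iff : ∀ u, (u, u, u) ∈ carrier ↔ u = proj
  eq_of_mirror : ∀ u v w, (u, v, w) ∈ carrier → (v, u, w) ∈ carrier → u = v ∧ v = w
  not_le_proj : ∀ u v w, (u, v, w) ∈ carrier → (u, v, w) ≠ (proj, proj, proj) →
    ¬ u ≤ proj ∧ ¬ v ≤ proj ∧ ¬ w ≤ proj

namespace FreeDistExt

section

variable {S : Type u} [SemilatticeSup S]

instance : LE (FreeDistExt S) where
  le x y := ∀ u v w, (u, v, w) ∈ x.carrier → (u, v, w) ∉ y.carrier → u ≤ y.proj ∨ w ≤ y.proj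

theorem le_def {x y : FreeDistExt S} : x ≤ y ↔ ∀ u v w, (u, v, w) ∈ x.carrier →
    (u, v, w) ∉ y.carrier → u ≤ y.proj ∨ w ≤ y.proj := Iff.rfl

theorem proj_mem (x : FreeDistExt S) : (x.proj, x.proj, x.proj) ∈ x.carrier :=
  (x.diag_mem_iff _).2 rfl

theorem proj_mono {x y : FreeDistExt S} (h : x ≤ y) : x.proj ≤ y.proj := by
  by_cases hm : (x.proj, x.proj, x.proj) ∈ y.carrier
  · exact ((y.diag_mem_iff _).1 hm).le
  · exact (h _ _ _ x.proj_mem hm).elim id id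

theorem subset_of_le_of_ge {x y : FreeDistExt S} (h : x ≤ y) (k : y ≤ x) :
    x.carrier ⊆ y.carrier := by
  have e : x.proj = y.proj := le_antisymm (proj_mono h) (proj_mono k)
  rintro ⟨u, v, w⟩ hx
  by_contra hy
  by_cases hd : (u, v, w) = (x.proj, x.proj, x.proj)
  · exact hy (by rw [hd, e]; exact y.proj_mem)
  · obtain ⟨h1, _, h3⟩ := x.not_le_proj u v w hx hd
    rcases h u v w hx hy with h' | h'
    · exact h1 (e ▸ h')
    · exact h3 (e ▸ h')

instance : PartialOrder (FreeDistExt S) where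
  le_refl _ _ _ _ h h' := absurd h h'
  le_trans x y z h k u v w hx hz := by
    by_cases hy : (u, v, w) ∈ y.carrier
    · exact k u v w hy hz
    · exact (h u v w hx hy).imp (fun a => a.trans (proj_mono k)) (fun a => a.trans (proj_mono k))
  le_antisymm x y h k := by
    have e : x.proj = y.proj := le_antisymm (proj_mono h) (proj_mono k)
    have e' : x.carrier = y.carrier :=
      Finset.Subset.antisymm (subset_of_le_of_ge h k) (subset_of_le_of_ge k h)
    cases x
    cases y
    cases e
    cases e'
    rfl

/-- The triple `(u, v, w)` is dominated by the reduced set `z`. -/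
def Below (t : S × S × S) (z : FreeDistExt S) : Prop :=
  t ∈ z.carrier ∨ t.1 ≤ z.proj ∨ t.2.2 ≤ z.proj

theorem le_iff_below {x z : FreeDistExt S} : x ≤ z ↔ ∀ t ∈ x.carrier, Below t z := by
  refine ⟨fun h t ht => ?_, fun h u v w hx hz => (h _ hx).resolve_left hz⟩
  by_cases hz : t ∈ z.carrier
  · exact Or.inl hz
  · exact Or.inr (h t.1 t.2.1 t.2.2 ht hz)

theorem below_diag_iff {p : S} {z : FreeDistExt S} : Below (p, p, p) z ↔ p ≤ z.proj := by
  refine ⟨fun h => ?_, fun h => Or.inr (Or.inl h)⟩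
  rcases h with h | h | h
  · exact ((z.diag_mem_iff p).1 h).le
  · exact h
  · exact h

theorem not_le_proj' {z : FreeDistExt S} {u v w : S} (h : (u, v, w) ∈ z.carrier)
    (hd : ¬ (u = v ∧ v = w)) : ¬ u ≤ z.proj ∧ ¬ v ≤ z.proj ∧ ¬ w ≤ z.proj := by
  refine z.not_le_proj u v w h fun e => hd ?_
  simp only [Prod.mk.injEq] at e
  exact ⟨e.1.trans e.2.1.symm, e.2.1.trans e.2.2.symm⟩

/-- For every `p` and every finite set `F` of non-diagonal triples in `C(S)`, there is a least
reduced set above `p` and above all the elements of `F`. -/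
theorem exists_reduct (n : ℕ) : ∀ (p : S) (F : Finset (S × S × S)), F.card ≤ n →
    (∀ u v w, (u, v, w) ∈ F → w ≤ u ⊔ v ∧ ¬ (u = v ∧ v = w)) →
    ∃ r : FreeDistExt S, ∀ z : FreeDistExt S, r ≤ z ↔ p ≤ z.proj ∧ ∀ t ∈ F, Below t z := by
  classical
  induction n with
  | zero =>
    intro p F hF _
    obtain rfl : F = ∅ := Finset.card_eq_zero.1 (Nat.le_zero.1 hF)
    refine ⟨⟨{(p, p, p)}, p, ?_, ?_, ?_, ?_⟩, fun z => ?_⟩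
    · intro u v w h
      simp only [Finset.mem_singleton, Prod.mk.injEq] at h
      obtain ⟨rfl, rfl, rfl⟩ := h
      exact le_sup_left
    · intro u
      simp
    · intro u v w h _
      simp only [Finset.mem_singleton, Prod.mk.injEq] at h
      obtain ⟨rfl, rfl, rfl⟩ := h
      exact ⟨rfl, rfl⟩
    · intro u v w h h'
      exact absurd (Finset.mem_singleton.1 h) h'
    · simp [le_iff_below, below_diag_iff]
  | succ n ih =>
    intro p F hF hC
    -- replacing a triple by an element `q` of `S`
    have step : ∀ (t : S × S × S) (q : S), t ∈ F →
        (∀ z : FreeDistExt S, (p ≤ z.proj ∧ ∀ s ∈ F, Below s z) ↔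
          (q ≤ z.proj ∧ ∀ s ∈ F.erase t, Below s z)) →
        ∃ r : FreeDistExt S, ∀ z : FreeDistExt S,
          r ≤ z ↔ p ≤ z.proj ∧ ∀ s ∈ F, Below s z := by
      intro t q ht hq
      obtain ⟨r, hr⟩ := ih q (F.erase t) (by rw [Finset.card_erase_of_mem ht]; omega)
        (fun u v w h => hC u v w (Finset.mem_of_mem_erase h))
      exact ⟨r, fun z => (hr z).trans (hq z).symm⟩
    have split : ∀ (t : S × S × S), t ∈ F → ∀ z : FreeDistExt S,
        (∀ s ∈ F, Below s z) ↔ (Below t z ∧ ∀ s ∈ F.erase t, Below s z) := by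
      intro t ht z
      rw [← Finset.forall_mem_insert _ _ (fun s => Below s z), Finset.insert_erase ht]
    by_cases h1 : ∃ a b c, (a, b, c) ∈ F ∧ (b, a, c) ∈ F
    · obtain ⟨a, b, c, h, h'⟩ := h1
      refine step (a, b, c) (p ⊔ c) h fun z => ?_
      rw [split _ h z, sup_le_iff]
      constructor
      · rintro ⟨hp, hb, hF'⟩
        refine ⟨⟨hp, ?_⟩, hF'⟩
        have hb' : Below (b, a, c) z := by
          by_cases e : (b, a, c) = (a, b, c)
          · rwa [e]
          · exact hF' _ (Finset.mem_erase.2 ⟨e, h'⟩)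
        have hle := (hC _ _ _ h).1
        have hd := (hC _ _ _ h).2
        have hd' := (hC _ _ _ h').2
        rcases hb with m | m | m
        · rcases hb' with m' | m' | m'
          · exact absurd (z.eq_of_mirror _ _ _ m m') hd
          · exact absurd m' (not_le_proj' m hd).2.1
          · exact m'
        · rcases hb' with m' | m' | m'
          · exact absurd m (not_le_proj' m' hd').2.1
          · exact hle.trans (sup_le m m')
          · exact m'
        · exact m
      · rintro ⟨⟨hp, hc⟩, hF'⟩
        exact ⟨hp, Or.inr (Or.inr hc), hF'⟩
    by_cases h2 : ∃ a b c, (a, b, c) ∈ F ∧ b ≤ p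
    · obtain ⟨a, b, c, h, hbp⟩ := h2
      refine step (a, b, c) (p ⊔ c) h fun z => ?_
      rw [split _ h z, sup_le_iff]
      constructor
      · rintro ⟨hp, hb, hF'⟩
        refine ⟨⟨hp, ?_⟩, hF'⟩
        rcases hb with m | m | m
        · exact absurd (hbp.trans hp) (not_le_proj' m (hC _ _ _ h).2).2.1
        · exact (hC _ _ _ h).1.trans (sup_le m (hbp.trans hp))
        · exact m
      · rintro ⟨⟨hp, hc⟩, hF'⟩
        exact ⟨hp, Or.inr (Or.inr hc), hF'⟩
    by_cases h3 : ∃ a b c, (a, b, c) ∈ F ∧ (a ≤ p ∨ c ≤ p)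
    · obtain ⟨a, b, c, h, hac⟩ := h3
      refine step (a, b, c) p h fun z => ?_
      rw [split _ h z]
      exact ⟨fun ⟨hp, _, hF'⟩ => ⟨hp, hF'⟩, fun ⟨hp, hF'⟩ =>
        ⟨hp, Or.inr (hac.imp (fun m => m.trans hp) (fun m => m.trans hp)), hF'⟩⟩
    -- no rule applies: the set is reduced
    push Not at h1 h2 h3
    refine ⟨⟨insert (p, p, p) F, p, ?_, ?_, ?_, ?_⟩, fun z => ?_⟩
    · intro u v w h
      rcases Finset.mem_insert.1 h with h | h
      · simp only [Prod.mk.injEq] at h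
        obtain ⟨rfl, rfl, rfl⟩ := h
        exact le_sup_left
      · exact (hC _ _ _ h).1
    · intro u
      rw [Finset.mem_insert]
      constructor
      · rintro (h | h)
        · exact (Prod.mk.inj h).1
        · exact absurd ⟨rfl, rfl⟩ (hC _ _ _ h).2
      · rintro rfl
        exact Or.inl rfl
    · intro u v w h h'
      rcases Finset.mem_insert.1 h with h | h
      · simp only [Prod.mk.injEq] at h
        obtain ⟨rfl, rfl, rfl⟩ := h
        exact ⟨rfl, rfl⟩
      · rcases Finset.mem_insert.1 h' with h' | h'
        · simp only [Prod.mk.injEq] at h'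
          obtain ⟨rfl, rfl, rfl⟩ := h'
          exact ⟨rfl, rfl⟩
        · exact absurd h' (h1 u v w h)
    · intro u v w h h'
      have m := (Finset.mem_insert.1 h).resolve_left h'
      exact ⟨(h3 u v w m).1, h2 u v w m, (h3 u v w m).2⟩
    · rw [le_iff_below, Finset.forall_mem_insert, below_diag_iff]

theorem exists_isLUB (x y : FreeDistExt S) : ∃ r : FreeDistExt S, ∀ z, r ≤ z ↔ x ≤ z ∧ y ≤ z := by
  classical
  obtain ⟨r, hr⟩ := exists_reduct _ (x.proj ⊔ y.proj)
    ((x.carrier ∪ y.carrier).filter fun t => ¬ (t.1 = t.2.1 ∧ t.2.1 = t.2.2)) le_rfl (by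
      intro u v w h
      rw [Finset.mem_filter, Finset.mem_union] at h
      exact ⟨h.1.elim (x.le_sup u v w) (y.le_sup u v w), h.2⟩)
  have key : ∀ (a z : FreeDistExt S), a ≤ z ↔ a.proj ≤ z.proj ∧
      ∀ t ∈ a.carrier, ¬ (t.1 = t.2.1 ∧ t.2.1 = t.2.2) → Below t z := by
    intro a z
    refine ⟨fun h => ⟨proj_mono h, fun t ht _ => le_iff_below.1 h t ht⟩, fun h => ?_⟩
    refine le_iff_below.2 fun t ht => ?_
    by_cases hd : t.1 = t.2.1 ∧ t.2.1 = t.2.2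
    · obtain ⟨t1, t2, t3⟩ := t
      obtain ⟨h1, h2⟩ := hd
      dsimp only at h1 h2
      subst h1 h2
      rw [below_diag_iff, (a.diag_mem_iff _).1 ht]
      exact h.1
    · exact h.2 t ht hd
  refine ⟨r, fun z => ?_⟩
  rw [hr z, key x z, key y z, sup_le_iff]
  constructor
  · rintro ⟨⟨h1, h2⟩, h⟩
    exact ⟨⟨h1, fun t ht hd => h t (Finset.mem_filter.2 ⟨Finset.mem_union_left _ ht, hd⟩)⟩,
      ⟨h2, fun t ht hd => h t (Finset.mem_filter.2 ⟨Finset.mem_union_right _ ht, hd⟩)⟩⟩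
  · rintro ⟨⟨h1, h1'⟩, h2, h2'⟩
    refine ⟨⟨h1, h2⟩, fun t ht => ?_⟩
    rw [Finset.mem_filter, Finset.mem_union] at ht
    exact ht.1.elim (fun m => h1' t m ht.2) (fun m => h2' t m ht.2)

/-- Any two reduced sets have a join, which the order determines. -/
noncomputable instance : SemilatticeSup (FreeDistExt S) where
  sup x y := (exists_isLUB x y).choose
  le_sup_left x y := ((exists_isLUB x y).choose_spec _).1 le_rfl |>.1
  le_sup_right x y := ((exists_isLUB x y).choose_spec _).1 le_rfl |>.2
  sup_le x y z h k := ((exists_isLUB x y).choose_spec z).2 ⟨h, k⟩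

/-- The canonical embedding `S → R(S)`, `a ↦ {(a, a, a)}`. -/
def emb (a : S) : FreeDistExt S where
  carrier := {(a, a, a)}
  proj := a
  le_sup u v w h := by
    simp only [Finset.mem_singleton, Prod.mk.injEq] at h
    obtain ⟨rfl, rfl, rfl⟩ := h
    exact le_sup_left
  diag_mem_iff u := by simp
  eq_of_mirror u v w h _ := by
    simp only [Finset.mem_singleton, Prod.mk.injEq] at h
    obtain ⟨rfl, rfl, rfl⟩ := h
    exact ⟨rfl, rfl⟩
  not_le_proj u v w h h' := absurd (Finset.mem_singleton.1 h) h'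

theorem emb_le_iff {a : S} {y : FreeDistExt S} : emb a ≤ y ↔ a ≤ y.proj := by
  simp [le_iff_below, emb, below_diag_iff]

theorem emb_le_emb_iff {a b : S} : emb a ≤ emb b ↔ a ≤ b := emb_le_iff

theorem emb_sup (a b : S) : emb (a ⊔ b) = emb a ⊔ emb b := by
  apply le_antisymm
  · exact emb_le_iff.2 (sup_le (emb_le_iff.1 le_sup_left) (emb_le_iff.1 le_sup_right))
  · exact sup_le (emb_le_emb_iff.2 le_sup_left) (emb_le_emb_iff.2 le_sup_right)

instance [OrderBot S] : OrderBot (FreeDistExt S) where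
  bot := emb ⊥
  bot_le _ := emb_le_iff.2 bot_le

end

/-- The iterates `Rⁿ(S)`, as join-semilattices with zero. -/
noncomputable def iter (S : Type u) [SemilatticeSup S] [OrderBot S] : ℕ → SemilatSupCat.{u}
  | 0 => SemilatSupCat.of S
  | n + 1 => SemilatSupCat.of (FreeDistExt (iter S n))

section

variable (S : Type u) [SemilatticeSup S] [OrderBot S]

/-- The inclusion `Rⁿ(S) → Rⁿ⁺¹(S)`. -/
noncomputable def iterSucc (n : ℕ) (x : iter S n) : iter S (n + 1) := emb (S := iter S n) x

/-- The inclusion `Rᵐ(S) → Rⁿ(S)` for `m ≤ n`, by composing the inclusions of one step. -/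
noncomputable def incl {m n : ℕ} (h : m ≤ n) : iter S m → iter S n :=
  Nat.leRecOn (C := fun k => iter S k) h fun {k} => iterSucc S k

variable {S}

theorem incl_self {n : ℕ} (x : iter S n) : incl S le_rfl x = x :=
  Nat.leRecOn_self (C := fun k => iter S k) (next := fun {k} => iterSucc S k) x

theorem incl_succ {m n : ℕ} (h : m ≤ n) (x : iter S m) :
    incl S (h.trans n.le_succ) x = iterSucc S n (incl S h x) :=
  Nat.leRecOn_succ (C := fun k => iter S k) (next := fun {k} => iterSucc S k) h x

theorem incl_incl {m n k : ℕ} (h : m ≤ n) (h' : n ≤ k) (x : iter S m) :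
    incl S h' (incl S h x) = incl S (h.trans h') x :=
  (Nat.leRecOn_trans (C := fun k => iter S k) h h' (next := fun {k} => iterSucc S k) x).symm

theorem incl_le_incl_iff {m n : ℕ} (h : m ≤ n) {x y : iter S m} :
    incl S h x ≤ incl S h y ↔ x ≤ y := by
  induction n, h using Nat.le_induction with
  | base => rw [incl_self, incl_self]
  | succ n h ih =>
    rw [incl_succ h, incl_succ h, ← ih]
    exact emb_le_emb_iff

theorem incl_sup {m n : ℕ} (h : m ≤ n) (x y : iter S m) :
    incl S h (x ⊔ y) = incl S h x ⊔ incl S h y := by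
  induction n, h using Nat.le_induction with
  | base => rw [incl_self, incl_self, incl_self]
  | succ n h ih =>
    rw [incl_succ h, incl_succ h, incl_succ h, ih]
    exact emb_sup _ _

theorem incl_bot {m n : ℕ} (h : m ≤ n) : incl S h (⊥ : iter S m) = ⊥ := by
  induction n, h using Nat.le_induction with
  | base => rw [incl_self]
  | succ n h ih =>
    rw [incl_succ h, ih]
    rfl

end

end FreeDistExt

/-- The disjoint union of the `Rⁿ(S)`, preordered by comparing two elements in a common `Rᵏ(S)`.
Its antisymmetrization is the increasing union of the `Rⁿ(S)` along the canonical embeddings. -/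
structure PreDistHull (S : Type u) [SemilatticeSup S] [OrderBot S] : Type u where
  level : ℕ
  val : FreeDistExt.iter S level

namespace PreDistHull

open FreeDistExt

section

variable {S : Type u} [SemilatticeSup S] [OrderBot S]

instance : LE (PreDistHull S) where
  le x y := incl S (le_max_left x.level y.level) x.val ≤
    incl S (le_max_right x.level y.level) y.val

theorem le_iff {x y : PreDistHull S} {k : ℕ} (hx : x.level ≤ k) (hy : y.level ≤ k) :
    x ≤ y ↔ incl S hx x.val ≤ incl S hy y.val := by
  rw [← incl_incl (le_max_left x.level y.level) (max_le hx hy),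
    ← incl_incl (le_max_right x.level y.level) (max_le hx hy), incl_le_incl_iff]
  exact Iff.rfl

instance : Preorder (PreDistHull S) where
  le_refl x := (le_iff le_rfl le_rfl).2 le_rfl
  le_trans x y z h h' := by
    have hx : x.level ≤ max x.level (max y.level z.level) := le_max_left _ _
    have hy : y.level ≤ max x.level (max y.level z.level) :=
      (le_max_left _ _).trans (le_max_right _ _)
    have hz : z.level ≤ max x.level (max y.level z.level) :=
      (le_max_right _ _).trans (le_max_right _ _)
    exact (le_iff hx hz).2 (((le_iff hx hy).1 h).trans ((le_iff hy hz).1 h'))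

/-- The join of two elements, formed in the first `Rᵏ(S)` that contains both. -/
noncomputable def join (x y : PreDistHull S) : PreDistHull S where
  level := max x.level y.level
  val := incl S (le_max_left x.level y.level) x.val ⊔ incl S (le_max_right x.level y.level) y.val

theorem join_le_iff {x y z : PreDistHull S} : join x y ≤ z ↔ x ≤ z ∧ y ≤ z := by
  have hxy : (join x y).level ≤ max (max x.level y.level) z.level := le_max_left _ _
  have hx : x.level ≤ max (max x.level y.level) z.level := (le_max_left _ _).trans hxy
  have hy : y.level ≤ max (max x.level y.level) z.level := (le_max_right _ _).trans hxy
  have hz : z.level ≤ max (max x.level y.level) z.level := le_max_right _ _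
  rw [le_iff hxy hz, le_iff hx hz, le_iff hy hz, ← sup_le_iff]
  have e : incl S hxy (join x y).val = incl S hx x.val ⊔ incl S hy y.val := by
    rw [← incl_incl (le_max_left x.level y.level) hxy, ← incl_incl (le_max_right x.level y.level)
      hxy]
    exact incl_sup hxy _ _
  rw [e]

end

end PreDistHull

/-- `D(S)`: the increasing union of the iterated free distributive extensions `Rⁿ(S)`. -/
def DistHull (S : Type u) [SemilatticeSup S] [OrderBot S] : Type u :=
  Antisymmetrization (PreDistHull S) (· ≤ ·)

namespace DistHull

section

variable {S : Type u} [SemilatticeSup S] [OrderBot S]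

instance : PartialOrder (DistHull S) :=
  inferInstanceAs (PartialOrder (Antisymmetrization (PreDistHull S) (· ≤ ·)))

/-- The canonical map `Rⁿ(S) → D(S)`. -/
noncomputable def mk (n : ℕ) (x : FreeDistExt.iter S n) : DistHull S := toAntisymmetrization (· ≤ ·) ⟨n, x⟩

theorem exists_isLUB (x y : DistHull S) : ∃ r : DistHull S, ∀ z, r ≤ z ↔ x ≤ z ∧ y ≤ z := by
  induction x using Antisymmetrization.ind with
  | _ x
  induction y using Antisymmetrization.ind with
  | _ y
  refine ⟨toAntisymmetrization (· ≤ ·) (PreDistHull.join x y), fun z => ?_⟩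
  induction z using Antisymmetrization.ind with
  | _ z
  exact PreDistHull.join_le_iff

noncomputable instance : SemilatticeSup (DistHull S) where
  sup x y := (exists_isLUB x y).choose
  le_sup_left x y := ((exists_isLUB x y).choose_spec _).1 le_rfl |>.1
  le_sup_right x y := ((exists_isLUB x y).choose_spec _).1 le_rfl |>.2
  sup_le x y z h k := ((exists_isLUB x y).choose_spec z).2 ⟨h, k⟩

noncomputable instance : OrderBot (DistHull S) where
  bot := mk 0 (⊥ : FreeDistExt.iter S 0)
  bot_le x := by
    induction x using Antisymmetrization.ind with
    | _ x
    refine (PreDistHull.le_iff (x := ⟨0, ⊥⟩) (y := x) (Nat.zero_le _) le_rfl).2 ?_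
    rw [FreeDistExt.incl_bot]
    exact bot_le

end

end DistHull

/-! ### The semilattices `L(Ω)` and `G(Ω)` -/

/-- `L(Ω)`: the join-semilattice with zero defined by generators `1`, `a₀^ξ`, `a₁^ξ` (`ξ ∈ Ω`) and
relations `a₀^ξ ∨ a₁^ξ = 1`. An element other than `1` is a finite join of generators `a_i^ξ` that
contains no pair `a₀^ξ`, `a₁^ξ`, that is, a pair `(X, Y)` of disjoint finite subsets of `Ω`, which
stands for the join of all `a₀^ξ` (`ξ ∈ X`) and all `a₁^ξ` (`ξ ∈ Y`); `⊤` is `1`. -/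
def GenSemilattice (Ω : Type u) : Type u :=
  WithTop {p : Finset Ω × Finset Ω // Disjoint p.1 p.2}

namespace GenSemilattice

section

variable {Ω : Type u}

instance : PartialOrder (GenSemilattice Ω) :=
  inferInstanceAs (PartialOrder (WithTop {p : Finset Ω × Finset Ω // Disjoint p.1 p.2}))

instance : OrderTop (GenSemilattice Ω) :=
  inferInstanceAs (OrderTop (WithTop {p : Finset Ω × Finset Ω // Disjoint p.1 p.2}))

/-- The element of `L(Ω)` given by a pair of disjoint finite sets. -/
def mk (X Y : Finset Ω) (h : Disjoint X Y) : GenSemilattice Ω :=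
  WithTop.some (⟨(X, Y), h⟩ : {p : Finset Ω × Finset Ω // Disjoint p.1 p.2})

theorem mk_le_mk_iff {X Y X' Y' : Finset Ω} {h : Disjoint X Y} {h' : Disjoint X' Y'} :
    mk X Y h ≤ mk X' Y' h' ↔ X ⊆ X' ∧ Y ⊆ Y' := WithTop.coe_le_coe

theorem eq_top_or_eq_mk (x : GenSemilattice Ω) : x = ⊤ ∨ ∃ X Y h, x = mk X Y h := by
  induction x using WithTop.recTopCoe with
  | top => exact Or.inl rfl
  | coe p => exact Or.inr ⟨p.1.1, p.1.2, p.2, rfl⟩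

theorem not_top_le_mk {X Y : Finset Ω} {h : Disjoint X Y} : ¬ (⊤ : GenSemilattice Ω) ≤ mk X Y h :=
  WithTop.not_top_le_coe _

instance : OrderBot (GenSemilattice Ω) where
  bot := mk ∅ ∅ (Finset.disjoint_empty_left _)
  bot_le x := by
    rcases eq_top_or_eq_mk x with rfl | ⟨X, Y, h, rfl⟩
    · exact le_top
    · exact mk_le_mk_iff.2 ⟨Finset.empty_subset _, Finset.empty_subset _⟩

theorem exists_isLUB (x y : GenSemilattice Ω) :
    ∃ r : GenSemilattice Ω, ∀ z, r ≤ z ↔ x ≤ z ∧ y ≤ z := by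
  classical
  rcases eq_top_or_eq_mk x with rfl | ⟨X, Y, h, rfl⟩
  · exact ⟨⊤, fun z => ⟨fun k => ⟨k, le_top.trans k⟩, fun k => k.1⟩⟩
  rcases eq_top_or_eq_mk y with rfl | ⟨X', Y', h', rfl⟩
  · exact ⟨⊤, fun z => ⟨fun k => ⟨le_top.trans k, k⟩, fun k => k.2⟩⟩
  by_cases hd : Disjoint (X ∪ X') (Y ∪ Y')
  · refine ⟨mk _ _ hd, fun z => ?_⟩
    rcases eq_top_or_eq_mk z with rfl | ⟨A, B, k, rfl⟩
    · simp only [le_top, and_self]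
    · rw [mk_le_mk_iff, mk_le_mk_iff, mk_le_mk_iff, Finset.union_subset_iff,
        Finset.union_subset_iff]
      tauto
  · refine ⟨⊤, fun z => ?_⟩
    rcases eq_top_or_eq_mk z with rfl | ⟨A, B, k, rfl⟩
    · simp only [le_top, and_self]
    · refine ⟨fun t => absurd t not_top_le_mk, fun t => absurd ?_ hd⟩
      rw [mk_le_mk_iff, mk_le_mk_iff] at t
      exact k.mono (Finset.union_subset t.1.1 t.2.1) (Finset.union_subset t.1.2 t.2.2)

/-- The join: the union of the pairs if it is a disjoint pair, and `1` otherwise. -/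
noncomputable instance : SemilatticeSup (GenSemilattice Ω) where
  sup x y := (exists_isLUB x y).choose
  le_sup_left x y := ((exists_isLUB x y).choose_spec _).1 le_rfl |>.1
  le_sup_right x y := ((exists_isLUB x y).choose_spec _).1 le_rfl |>.2
  sup_le x y z h k := ((exists_isLUB x y).choose_spec z).2 ⟨h, k⟩

end

end GenSemilattice

/-- `G(Ω) = D(L(Ω))`. -/
abbrev GSemilattice (Ω : Type u) : Type u := DistHull (GenSemilattice Ω)

/-! ### Algebraic distributive lattices -/

/-- The complete lattice `D` is distributive and algebraic, that is, each of its elements is a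
join of compact elements. -/
def IsAlgebraicDistributive (D : Type u) [CompleteLattice D] : Prop :=
  IsCompactlyGenerated D ∧ ∀ a b c : D, a ⊓ (b ⊔ c) = (a ⊓ b) ⊔ (a ⊓ c)

/-! ### One-step lemmas on the free distributive extension -/

namespace FreeDistExt

section

variable {S : Type u} [SemilatticeSup S]

/-! Suppose that `e` identifies `Con_c L` with G(Ω). The congruence corresponding to 1 is nonzero
and lies below some Θ(s, t) with s ≤ t, so it is enough to show s = t. For each ξ, the relation a₀^ξ
∨ a₁^ξ = 1 yields a chain from s to t inside [s, t] whose steps alternate between the congruences of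
a₀^ξ and a₁^ξ. As ℵ_{ω+1} is regular and uncountable, ℵ_{ω+1} many ξ share one chain length N. Every
element of G(Ω) involves finitely many indices, so Kuratowski's theorem gives 2^N + 1 of these ξ
such that congruences built from some of the chains do not involve the index of any other chain in
the family.

Two lemmas then collide. Erosion (`exists_erosion`), which holds in every lattice, uses the chain of
an index δ to bound Θ(x₀ ∨ x₁, t) by a join of two congruences, the j-th below both a_j^δ and Θ(x_j,
t). Evaporation (`eq_bot_of_le_sup`), which is special to G(Ω), says that such a join has only zero
below it among elements not involving δ, if the two parts lie below generators of distinct indices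
α, β and each part does not involve the other's index. Together they give x₀ ∨ x₁ = t. So two
chains, one step lower, do jointly what either did alone (`IsFreeChainFamily.sup_sup_eq`). After N
doublings, 2^N chains at their starting point s have join t, whence s = t.

Evaporation is proved by induction along Rⁿ(L(Ω)): under its hypotheses no reduction rule creates
new triples in the join, so triples can be inspected one by one. The positive claims rest on the
mirror triples (u, v, w) and (v, u, w), which split w ≤ u ∨ v in R(S) and make D(S) distributive, on
the compact ideals being the principal ones, and on a cardinality count. -/

theorem le_emb_iff {x : FreeDistExt S} {a : S} :
    x ≤ emb a ↔ ∀ t ∈ x.carrier, t.1 ≤ a ∨ t.2.2 ≤ a := by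
  rw [le_iff_below]
  refine forall₂_congr fun t _ => ⟨fun h => h.elim (fun h => ?_) id, Or.inr⟩
  rw [Finset.mem_singleton.1 h]
  exact Or.inl le_rfl

/-- If the union of two reduced sets contains no mirror pair and no triple whose middle entry is
absorbed, then their join only contains triples of that union. -/
theorem mem_or_le_of_le_sup {x y z : FreeDistExt S}
    (hm : ∀ u v w, (u, v, w) ∈ x.carrier → (v, u, w) ∈ y.carrier → u = v ∧ v = w)
    (hx : ∀ u v w, (u, v, w) ∈ x.carrier → ¬ (u = v ∧ v = w) → ¬ v ≤ x.proj ⊔ y.proj)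
    (hy : ∀ u v w, (u, v, w) ∈ y.carrier → ¬ (u = v ∧ v = w) → ¬ v ≤ x.proj ⊔ y.proj)
    (hz : z ≤ x ⊔ y) {t : S × S × S} (ht : t ∈ z.carrier) :
    (t ∈ x.carrier ∨ t ∈ y.carrier) ∨ t.1 ≤ x.proj ⊔ y.proj ∨ t.2.2 ≤ x.proj ⊔ y.proj := by
  classical
  let p := x.proj ⊔ y.proj
  -- An explicit upper bound of `x` and `y` suffices. The triples with first or last entry below `p`
  -- are dropped; the three hypotheses say that what remains is already reduced.
  let r : FreeDistExt S :=
    { carrier := insert (p, p, p) ((x.carrier ∪ y.carrier).filter fun t =>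
        ¬ (t.1 = t.2.1 ∧ t.2.1 = t.2.2) ∧ ¬ t.1 ≤ p ∧ ¬ t.2.2 ≤ p)
      proj := p
      le_sup := by
        intro u v w h
        simp only [Finset.mem_insert, Finset.mem_filter, Finset.mem_union, Prod.mk.injEq] at h
        rcases h with ⟨rfl, rfl, rfl⟩ | ⟨h, -⟩
        · exact le_sup_left
        · exact h.elim (x.le_sup u v w) (y.le_sup u v w)
      diag_mem_iff := by
        intro u
        simp
      eq_of_mirror := by
        intro u v w h h'
        simp only [Finset.mem_insert, Finset.mem_filter, Finset.mem_union, Prod.mk.injEq] at h h'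
        rcases h with ⟨rfl, rfl, rfl⟩ | ⟨h, -⟩
        · exact ⟨rfl, rfl⟩
        rcases h' with ⟨rfl, rfl, rfl⟩ | ⟨h', -⟩
        · exact ⟨rfl, rfl⟩
        rcases h with h | h <;> rcases h' with h' | h'
        · exact x.eq_of_mirror _ _ _ h h'
        · exact hm _ _ _ h h'
        · obtain ⟨rfl, rfl⟩ := hm _ _ _ h' h
          exact ⟨rfl, rfl⟩
        · exact y.eq_of_mirror _ _ _ h h'
      not_le_proj := by
        intro u v w h h'
        obtain ⟨h1, h2, h3, h4⟩ := Finset.mem_filter.1 ((Finset.mem_insert.1 h).resolve_left h')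
        exact ⟨h3, (Finset.mem_union.1 h1).elim (fun h => hx _ _ _ h h2) (fun h => hy _ _ _ h h2),
          h4⟩ }
  have key : ∀ s : FreeDistExt S, s.proj ≤ p → s.carrier ⊆ x.carrier ∪ y.carrier → s ≤ r := by
    intro s hp hs
    refine le_iff_below.2 fun t ht => ?_
    by_cases h1 : t.1 ≤ p
    · exact Or.inr (Or.inl h1)
    by_cases h2 : t.2.2 ≤ p
    · exact Or.inr (Or.inr h2)
    refine Or.inl (Finset.mem_insert_of_mem (Finset.mem_filter.2 ⟨hs ht, fun h => h1 ?_, h1, h2⟩))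
    obtain ⟨a, b, c⟩ := t
    obtain ⟨rfl, rfl⟩ : a = b ∧ b = c := h
    exact ((s.diag_mem_iff a).1 ht).le.trans hp
  have hr : z ≤ r := hz.trans (sup_le (key x le_sup_left Finset.subset_union_left)
    (key y le_sup_right Finset.subset_union_right))
  rcases le_iff_below.1 hr t ht with h | h
  · rcases Finset.mem_insert.1 h with rfl | h
    · exact Or.inr (Or.inl le_rfl)
    · exact Or.inl (Finset.mem_union.1 (Finset.mem_filter.1 h).1)
  · exact Or.inr h

/-- The reduced sets all of whose entries belong to `A`. -/
def lift (A : Set S) : Set (FreeDistExt S) :=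
  {x | ∀ t ∈ x.carrier, t.1 ∈ A ∧ t.2.1 ∈ A ∧ t.2.2 ∈ A}

theorem emb_mem_lift {A : Set S} {a : S} (h : a ∈ A) : emb a ∈ lift A := by
  intro t ht
  rw [Finset.mem_singleton.1 ht]
  exact ⟨h, h, h⟩

theorem proj_mem_of_mem_lift {A : Set S} {x : FreeDistExt S} (h : x ∈ lift A) : x.proj ∈ A :=
  (h _ x.proj_mem).1

/-- `a` is independent of `A` if joining it does not change the order on `A`. -/
def Indep (A : Set S) (a : S) : Prop := ∀ v ∈ A, ∀ c ∈ A, v ≤ c ⊔ a → v ≤ c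

/-- The only triple of `emb a` is diagonal, and independence prevents `c.proj ⊔ a` from absorbing a
middle entry of `c`. So the join with `emb a` contributes no new triples, and entries of `x` below
`c.proj ⊔ a` are already below `c.proj`. -/
theorem Indep.lift {A : Set S} {a : S} (h : Indep A a) : Indep (lift A) (emb a) := by
  intro x hx c hc hle
  have hproj : ∀ v ∈ A, v ≤ c.proj ⊔ a → v ≤ c.proj := fun v hv =>
    h v hv _ (proj_mem_of_mem_lift hc)
  have hmem : ∀ u v w, (u, v, w) ∈ (emb a).carrier → u = a ∧ v = a ∧ w = a := by
    intro u v w m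
    simpa [emb] using m
  refine le_iff_below.2 fun t ht => ?_
  have := mem_or_le_of_le_sup (x := c) (y := emb a) ?_ ?_ ?_ hle ht
  · rcases this with (h' | h') | h' | h'
    · exact Or.inl h'
    · obtain ⟨e, -, -⟩ := hmem _ _ _ h'
      exact Or.inr (Or.inl (hproj _ (hx t ht).1 (e ▸ le_sup_right)))
    · exact Or.inr (Or.inl (hproj _ (hx t ht).1 h'))
    · exact Or.inr (Or.inr (hproj _ (hx t ht).2.2 h'))
  · intro u v w m m'
    obtain ⟨rfl, rfl, rfl⟩ := hmem _ _ _ m'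
    exact ⟨rfl, rfl⟩
  · intro u v w m hd hv
    exact (not_le_proj' m hd).2.1 (hproj v (hc _ m).2.1 hv)
  · intro u v w m hd
    obtain ⟨rfl, rfl, rfl⟩ := hmem _ _ _ m
    exact absurd ⟨rfl, rfl⟩ hd

end

section

variable {S : Type u} [SemilatticeSup S] [OrderBot S]

/-- Every element of `C` that lies below a join of an element of `B` below `d`, `a` and an element
of `A` below `d'`, `b` is zero. -/
def Evaporates (A B C : Set S) (a b d d' : S) : Prop :=
  ∀ x ∈ B, ∀ y ∈ A, ∀ z ∈ C, x ≤ d → x ≤ a → y ≤ d' → y ≤ b → z ≤ x ⊔ y → z ≤ ⊥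

theorem Indep.le_bot {A : Set S} {a v : S} (h : Indep A a) (hA : ⊥ ∈ A) (hv : v ∈ A)
    (hle : v ≤ a) : v ≤ ⊥ :=
  h v hv ⊥ hA (hle.trans le_sup_right)

/-- `mem_or_le_of_le_sup` applies to `x ⊔ y`. In a nondiagonal mirror pair, `x ≤ emb a` puts an
entry below `a`; it also occurs in `y`, hence avoids `a` and is zero, which reducedness forbids.
Middle entries are not absorbed because `x` is independent of `b` and `y` of `a`. A triple of `z`
coming from `x` or `y` then has an entry below `d` or `d'` that is zero by independence; otherwise
an entry lies below the join of the projections, where the hypothesis one level down applies. -/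
theorem Evaporates.lift {A B C : Set S} {a b d d' : S} (h : Evaporates A B C a b d d')
    (bA : ⊥ ∈ A) (bC : ⊥ ∈ C) (hA : Indep A a) (hB : Indep B b) (hC : Indep C d)
    (hC' : Indep C d') :
    Evaporates (lift A) (lift B) (lift C) (emb a) (emb b) (emb d) (emb d') := by
  intro x hx y hy z hz hxd hxa hyd hyb hzxy
  rw [le_emb_iff] at hxd hxa hyd hyb
  have hpxd := (hxd _ x.proj_mem).elim id id
  have hpxa := (hxa _ x.proj_mem).elim id id
  have hpyd := (hyd _ y.proj_mem).elim id id
  have hpyb := (hyb _ y.proj_mem).elim id id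
  have hev : ∀ w ∈ C, w ≤ x.proj ⊔ y.proj → w ≤ ⊥ := fun w hw =>
    h _ (proj_mem_of_mem_lift hx) _ (proj_mem_of_mem_lift hy) w hw hpxd hpxa hpyd hpyb
  refine le_emb_iff.2 fun t ht => ?_
  have := mem_or_le_of_le_sup ?_ ?_ ?_ hzxy ht
  · rcases this with (h' | h') | h'
    · exact (hxd t h').imp (hC.le_bot bC (hz t ht).1) (hC.le_bot bC (hz t ht).2.2)
    · exact (hyd t h').imp (hC'.le_bot bC (hz t ht).1) (hC'.le_bot bC (hz t ht).2.2)
    · exact h'.imp (hev _ (hz t ht).1) (hev _ (hz t ht).2.2)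
  · intro u v w m m'
    by_contra hd
    have n := not_le_proj' m hd
    rcases hxa _ m with k | k
    · exact n.1 ((hA.le_bot bA (hy _ m').2.1 k).trans bot_le)
    · exact n.2.2 ((hA.le_bot bA (hy _ m').2.2 k).trans bot_le)
  · intro u v w m hd hv
    exact (not_le_proj' m hd).2.1 (hB v (hx _ m).2.1 _ (proj_mem_of_mem_lift hx)
      (hv.trans (sup_le_sup_left hpyb _)))
  · intro u v w m hd hv
    exact (not_le_proj' m hd).2.1 (hA v (hy _ m).2.1 _ (proj_mem_of_mem_lift hy)
      (hv.trans (sup_le (hpxa.trans le_sup_right) le_sup_left)))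

end

/-- An element below `u ⊔ v` splits in `R(S)` into an element below `u` and one below `v`. -/
theorem exists_split {S : Type u} [SemilatticeSup S] [OrderBot S] {u v w : S} (h : w ≤ u ⊔ v) :
    ∃ x y : FreeDistExt S, x ≤ emb u ∧ y ≤ emb v ∧ x ⊔ y = emb w := by
  classical
  by_cases hd : u = v ∧ v = w
  · obtain ⟨rfl, rfl⟩ := hd
    exact ⟨emb u, emb u, le_rfl, le_rfl, sup_idem _⟩
  have hd' : ¬ (v = u ∧ u = w) := fun ⟨e, e'⟩ => hd ⟨e.symm, e.trans e'⟩
  -- The two parts come from the mirror triples. Each is absorbed by its first entry and by `w`, and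
  -- no reduced set can contain both triples without having absorbed `w`.
  obtain ⟨x, hx⟩ := exists_reduct 1 (⊥ : S) {(u, v, w)} (by simp) (by
    intro _ _ _ m
    simp only [Finset.mem_singleton, Prod.mk.injEq] at m
    obtain ⟨rfl, rfl, rfl⟩ := m
    exact ⟨h, hd⟩)
  obtain ⟨y, hy⟩ := exists_reduct 1 (⊥ : S) {(v, u, w)} (by simp) (by
    intro _ _ _ m
    simp only [Finset.mem_singleton, Prod.mk.injEq] at m
    obtain ⟨rfl, rfl, rfl⟩ := m
    exact ⟨h.trans (sup_comm _ _).le, hd'⟩)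
  simp only [bot_le, true_and, Finset.mem_singleton, forall_eq] at hx hy
  refine ⟨x, y, (hx _).2 (Or.inr (Or.inl le_rfl)), (hy _).2 (Or.inr (Or.inl le_rfl)),
    le_antisymm (sup_le ((hx _).2 (Or.inr (Or.inr le_rfl))) ((hy _).2 (Or.inr (Or.inr le_rfl)))) ?_⟩
  rw [emb_le_iff]
  generalize hz : x ⊔ y = z
  have h1 := (hx z).1 (hz ▸ le_sup_left)
  have h2 := (hy z).1 (hz ▸ le_sup_right)
  rcases h1 with m | m | m
  · rcases h2 with m' | m' | m'
    · exact absurd (z.eq_of_mirror _ _ _ m m') hd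
    · exact absurd m' (not_le_proj' m hd).2.1
    · exact m'
  · rcases h2 with m' | m' | m'
    · exact absurd m (not_le_proj' m' hd').2.1
    · exact h.trans (sup_le m m')
    · exact m'
  · exact m

end FreeDistExt

/-! ### Generators and supports in `L(Ω)` -/

namespace GenSemilattice

section

variable {Ω : Type u}

/-- The generator `a₀^ξ` or `a₁^ξ`. -/
def gen (ξ : Ω) : Bool → GenSemilattice Ω
  | false => mk {ξ} ∅ (Finset.disjoint_empty_right _)
  | true => mk ∅ {ξ} (Finset.disjoint_empty_left _)

theorem gen_sup_gen (ξ : Ω) : gen ξ false ⊔ gen ξ true = ⊤ := by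
  have h1 : gen ξ false ≤ gen ξ false ⊔ gen ξ true := le_sup_left
  have h2 : gen ξ true ≤ gen ξ false ⊔ gen ξ true := le_sup_right
  rcases eq_top_or_eq_mk (gen ξ false ⊔ gen ξ true) with h | ⟨X, Y, h, e⟩
  · exact h
  rw [e] at h1 h2
  exact absurd h (Finset.not_disjoint_iff.2 ⟨ξ, Finset.singleton_subset_iff.1 (mk_le_mk_iff.1 h1).1,
    Finset.singleton_subset_iff.1 (mk_le_mk_iff.1 h2).2⟩)

theorem gen_false_injective : Function.Injective fun ξ : Ω => gen ξ false := by
  intro ξ η h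
  have : gen ξ false ≤ gen η false := h.le
  exact Finset.mem_singleton.1 (Finset.singleton_subset_iff.1 (mk_le_mk_iff.1 this).1)

/-- The elements of `L(Ω)` that do not involve `ξ`. -/
def avoid (ξ : Ω) : Set (GenSemilattice Ω) :=
  {x | x = ⊤ ∨ ∃ X Y h, x = mk X Y h ∧ ξ ∉ X ∧ ξ ∉ Y}

theorem bot_mem_avoid (ξ : Ω) : ⊥ ∈ avoid ξ :=
  Or.inr ⟨∅, ∅, Finset.disjoint_empty_left _, rfl, Finset.notMem_empty _, Finset.notMem_empty _⟩

theorem finite_notMem_avoid (x : GenSemilattice Ω) : {ξ | x ∉ avoid ξ}.Finite := by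
  classical
  rcases eq_top_or_eq_mk x with rfl | ⟨X, Y, h, rfl⟩
  · refine Set.finite_empty.subset fun ξ hξ => hξ (Or.inl rfl)
  · refine (X ∪ Y).finite_toSet.subset fun ξ hξ => ?_
    by_contra hn
    rw [Finset.mem_coe, Finset.mem_union, not_or] at hn
    exact hξ (Or.inr ⟨X, Y, h, rfl, hn⟩)

/-- Inserting ξ on one side of a disjoint pair that omits ξ keeps the pair disjoint, so the join
stays different from 1 and gains nothing but ξ. -/
theorem indep_avoid_gen (ξ : Ω) (i : Bool) : FreeDistExt.Indep (avoid ξ) (gen ξ i) := by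
  classical
  rintro v hv c (rfl | ⟨X, Y, h, rfl, hX, hY⟩) hle
  · exact le_top
  have key : ∃ X' Y' h', mk X Y h ⊔ gen ξ i ≤ mk X' Y' h' ∧ X' ⊆ insert ξ X ∧ Y' ⊆ insert ξ Y := by
    cases i
    · refine ⟨insert ξ X, Y, Finset.disjoint_insert_left.2 ⟨hY, h⟩, sup_le ?_ ?_, subset_rfl,
        Finset.subset_insert _ _⟩
      · exact mk_le_mk_iff.2 ⟨Finset.subset_insert _ _, subset_rfl⟩
      · exact mk_le_mk_iff.2 ⟨by simp, by simp⟩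
    · refine ⟨X, insert ξ Y, Finset.disjoint_insert_right.2 ⟨hX, h⟩, sup_le ?_ ?_,
        Finset.subset_insert _ _, subset_rfl⟩
      · exact mk_le_mk_iff.2 ⟨subset_rfl, Finset.subset_insert _ _⟩
      · exact mk_le_mk_iff.2 ⟨by simp, by simp⟩
  obtain ⟨X', Y', h', hle', hX', hY'⟩ := key
  rcases hv with rfl | ⟨A, B, hAB, rfl, hA, hB⟩
  · exact absurd (hle.trans hle') not_top_le_mk
  · have := mk_le_mk_iff.1 (hle.trans hle')
    exact mk_le_mk_iff.2 ⟨(Finset.subset_insert_iff_of_notMem hA).1 (this.1.trans hX'),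
      (Finset.subset_insert_iff_of_notMem hB).1 (this.2.trans hY')⟩

theorem le_bot_of_le_gen {ξ η : Ω} (h : ξ ≠ η) {i j : Bool} {x : GenSemilattice Ω}
    (hi : x ≤ gen ξ i) (hj : x ≤ gen η j) : x ≤ ⊥ := by
  have hx : x ∈ avoid ξ := by
    rcases eq_top_or_eq_mk x with rfl | ⟨X, Y, hXY, rfl⟩
    · exact Or.inl rfl
    refine Or.inr ⟨X, Y, hXY, rfl, ?_⟩
    cases j
    · have := mk_le_mk_iff.1 hj
      exact ⟨fun m => h (by simpa using this.1 m), fun m => by simpa using this.2 m⟩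
    · have := mk_le_mk_iff.1 hj
      exact ⟨fun m => by simpa using this.1 m, fun m => h (by simpa using this.2 m)⟩
  exact (indep_avoid_gen ξ i).le_bot (bot_mem_avoid ξ) hx hi

/-- In L(Ω) both `x` and `y` vanish, since each lies below two generators of distinct indices. In
higher iterates a nonzero element can lie below two such generators. -/
theorem evaporates {α β δ : Ω} (hα : δ ≠ α) (hβ : δ ≠ β) (i j k l : Bool) :
    FreeDistExt.Evaporates (avoid α) (avoid β) (avoid δ) (gen α k) (gen β l) (gen δ i)
      (gen δ j) :=
  fun _ _ _ _ _ _ hxd hxa hyd hyb hz =>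
    hz.trans (sup_le (le_bot_of_le_gen hα hxd hxa) (le_bot_of_le_gen hβ hyd hyb))

end

end GenSemilattice

/-! ### Supports in the iterates `Rⁿ(L(Ω))` -/

namespace FreeDistExt

section

variable {S : Type u} [SemilatticeSup S] [OrderBot S]

/-- The elements of `S` as elements of `R⁰(S)`. -/
def ofBase (x : S) : iter S 0 := x

/-- The elements of `R(Rⁿ(S))` as elements of `Rⁿ⁺¹(S)`. -/
def ofExt {n : ℕ} (x : FreeDistExt (iter S n)) : iter S (n + 1) := x

end

section

variable {Ω : Type u}

/-- The elements of `Rⁿ(L(Ω))` that do not involve `ξ`. -/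
def avoid (ξ : Ω) : ∀ n : ℕ, Set (iter (GenSemilattice Ω) n)
  | 0 => GenSemilattice.avoid ξ
  | n + 1 => lift (S := iter (GenSemilattice Ω) n) (avoid ξ n)

/-- The generators in `Rⁿ(L(Ω))`. -/
noncomputable def gen (ξ : Ω) (i : Bool) (n : ℕ) : iter (GenSemilattice Ω) n :=
  incl (GenSemilattice Ω) n.zero_le (ofBase (GenSemilattice.gen ξ i))

theorem gen_succ (ξ : Ω) (i : Bool) (n : ℕ) :
    gen ξ i (n + 1) = emb (S := iter (GenSemilattice Ω) n) (gen ξ i n) :=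
  incl_succ n.zero_le _

theorem bot_mem_avoid (ξ : Ω) (n : ℕ) : (⊥ : iter (GenSemilattice Ω) n) ∈ avoid ξ n := by
  induction n with
  | zero => exact GenSemilattice.bot_mem_avoid ξ
  | succ n ih => exact emb_mem_lift ih

theorem finite_notMem_avoid (n : ℕ) (x : iter (GenSemilattice Ω) n) :
    {ξ | x ∉ avoid ξ n}.Finite := by
  induction n with
  | zero => exact GenSemilattice.finite_notMem_avoid x
  | succ n ih =>
    let y : FreeDistExt (iter (GenSemilattice Ω) n) := x
    refine (y.carrier.finite_toSet.biUnion fun t _ =>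
      ((ih t.1).union ((ih t.2.1).union (ih t.2.2)))).subset fun ξ hξ => ?_
    by_contra hn
    refine hξ fun t ht => ?_
    simp only [Set.mem_iUnion, not_exists, Set.mem_union, not_or, Set.mem_ofPred_eq, not_not] at hn
    exact hn t ht

theorem indep_avoid_gen (ξ : Ω) (i : Bool) (n : ℕ) : Indep (avoid ξ n) (gen ξ i n) := by
  induction n with
  | zero =>
    rw [gen, incl_self]
    exact GenSemilattice.indep_avoid_gen ξ i
  | succ n ih =>
    rw [gen_succ]
    exact ih.lift

theorem evaporates {α β δ : Ω} (hα : δ ≠ α) (hβ : δ ≠ β) (i j k l : Bool) (n : ℕ) :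
    Evaporates (avoid α n) (avoid β n) (avoid δ n) (gen α k n) (gen β l n) (gen δ i n)
      (gen δ j n) := by
  induction n with
  | zero =>
    simp only [gen, incl_self]
    exact GenSemilattice.evaporates hα hβ i j k l
  | succ n ih =>
    simp only [gen_succ]
    exact ih.lift (bot_mem_avoid _ _) (bot_mem_avoid _ _)
      (indep_avoid_gen _ _ _) (indep_avoid_gen _ _ _) (indep_avoid_gen _ _ _)
      (indep_avoid_gen _ _ _)

theorem incl_mem_avoid {ξ : Ω} {m n : ℕ} (h : m ≤ n) {x : iter (GenSemilattice Ω) m}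
    (hx : x ∈ avoid ξ m) : incl (GenSemilattice Ω) h x ∈ avoid ξ n := by
  induction n, h using Nat.le_induction with
  | base => rwa [incl_self]
  | succ n h ih =>
    rw [incl_succ h]
    exact emb_mem_lift ih

theorem le_incl_top (n : ℕ) (x : iter (GenSemilattice Ω) n) :
    x ≤ incl (GenSemilattice Ω) n.zero_le (ofBase ⊤) := by
  induction n with
  | zero =>
    rw [incl_self]
    exact le_top (α := GenSemilattice Ω)
  | succ n ih =>
    rw [incl_succ n.zero_le]
    exact le_emb_iff.2 fun t _ => Or.inl (ih t.1)

end

end FreeDistExt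

/-! ### The semilattices `D(S)` and `G(Ω)` -/

namespace DistHull

open FreeDistExt

section

variable {S : Type u} [SemilatticeSup S] [OrderBot S]

theorem mk_le_mk_iff {m n k : ℕ} (hm : m ≤ k) (hn : n ≤ k) {x : iter S m} {y : iter S n} :
    mk m x ≤ mk n y ↔ incl S hm x ≤ incl S hn y :=
  PreDistHull.le_iff (x := ⟨m, x⟩) (y := ⟨n, y⟩) hm hn

theorem mk_le_mk {n : ℕ} {x y : iter S n} : mk n x ≤ mk n y ↔ x ≤ y := by
  rw [mk_le_mk_iff le_rfl le_rfl, incl_self, incl_self]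

theorem mk_incl {m n : ℕ} (h : m ≤ n) (x : iter S m) : mk n (incl S h x) = mk m x := by
  apply le_antisymm
  · rw [mk_le_mk_iff le_rfl h, incl_self]
  · rw [mk_le_mk_iff h le_rfl, incl_self]

theorem exists_eq_mk (x : DistHull S) : ∃ n y, x = mk n y := by
  induction x using Antisymmetrization.ind with
  | _ x => exact ⟨x.level, x.val, rfl⟩

theorem exists_eq_mk_of_le {m n : ℕ} (h : m ≤ n) (x : iter S m) : ∃ y, mk m x = mk n y :=
  ⟨incl S h x, (mk_incl h x).symm⟩

theorem mk_sup (n : ℕ) (x y : iter S n) : mk n (x ⊔ y) = mk n x ⊔ mk n y := by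
  apply le_antisymm
  · obtain ⟨m, z, hz⟩ := exists_eq_mk (mk n x ⊔ mk n y)
    have h1 : mk n x ≤ mk m z := hz ▸ le_sup_left
    have h2 : mk n y ≤ mk m z := hz ▸ le_sup_right
    rw [hz, mk_le_mk_iff (le_max_left n m) (le_max_right n m), incl_sup]
    rw [mk_le_mk_iff (le_max_left n m) (le_max_right n m)] at h1 h2
    exact sup_le h1 h2
  · exact sup_le (mk_le_mk.2 le_sup_left) (mk_le_mk.2 le_sup_right)

theorem mk_bot (n : ℕ) : mk n (⊥ : iter S n) = ⊥ := by
  rw [← incl_bot n.zero_le, mk_incl]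
  rfl

/-- `D(S)` is a distributive join-semilattice. -/
theorem exists_split {u v w : DistHull S} (h : w ≤ u ⊔ v) :
    ∃ x y, x ≤ u ∧ y ≤ v ∧ x ⊔ y = w := by
  obtain ⟨a, u, rfl⟩ := exists_eq_mk u
  obtain ⟨b, v, rfl⟩ := exists_eq_mk v
  obtain ⟨c, w, rfl⟩ := exists_eq_mk w
  obtain ⟨u, e⟩ := exists_eq_mk_of_le (le_max_left a (max b c)) u
  rw [e] at h ⊢
  obtain ⟨v, e⟩ := exists_eq_mk_of_le ((le_max_left b c).trans (le_max_right a (max b c))) v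
  rw [e] at h ⊢
  obtain ⟨w, e⟩ := exists_eq_mk_of_le ((le_max_right b c).trans (le_max_right a (max b c))) w
  rw [e] at h ⊢
  generalize max a (max b c) = n at *
  rw [← mk_sup, mk_le_mk] at h
  obtain ⟨x, y, hx, hy, hxy⟩ := FreeDistExt.exists_split h
  have hmk : ∀ s : iter S n, mk n s = mk (n + 1) (ofExt (emb (S := iter S n) s)) := by
    intro s
    rw [← mk_incl n.le_succ s, incl_succ le_rfl, incl_self]
    rfl
  refine ⟨mk (n + 1) (ofExt x), mk (n + 1) (ofExt y), ?_, ?_, ?_⟩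
  · rw [hmk, mk_le_mk]
    exact hx
  · rw [hmk, mk_le_mk]
    exact hy
  · rw [hmk w, ← hxy]
    exact (mk_sup (n + 1) (ofExt x) (ofExt y)).symm

end

end DistHull

/-! ### Finite supports and evaporation in G(Ω). -/

namespace GSemilattice

open FreeDistExt

section

variable {Ω : Type u}

/-- The generators of `G(Ω)`. -/
noncomputable def gen (ξ : Ω) (i : Bool) : GSemilattice Ω :=
  DistHull.mk 0 (ofBase (GenSemilattice.gen ξ i))

/-- The elements of `G(Ω)` that do not involve `ξ`. -/
def avoid (ξ : Ω) : Set (GSemilattice Ω) :=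
  {x | ∃ n, ∃ y ∈ FreeDistExt.avoid ξ n, x = DistHull.mk n y}

/-- The largest element of `G(Ω)`. -/
noncomputable def one : GSemilattice Ω := DistHull.mk 0 (ofBase ⊤)

theorem le_one (x : GSemilattice Ω) : x ≤ one := by
  obtain ⟨n, x, rfl⟩ := DistHull.exists_eq_mk x
  rw [one, DistHull.mk_le_mk_iff le_rfl n.zero_le, incl_self]
  exact le_incl_top n x

theorem gen_sup_gen (ξ : Ω) : gen ξ false ⊔ gen ξ true = one := by
  rw [gen, gen, ← DistHull.mk_sup]
  exact congrArg _ (GenSemilattice.gen_sup_gen ξ)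

theorem bot_ne_one : (⊥ : GSemilattice Ω) ≠ one := fun h =>
  GenSemilattice.not_top_le_mk (DistHull.mk_le_mk.1 h.ge :
    (⊤ : GenSemilattice Ω) ≤ ⊥)

theorem gen_false_injective : Function.Injective fun ξ : Ω => gen ξ false := by
  intro ξ η h
  exact GenSemilattice.gen_false_injective
    (le_antisymm (DistHull.mk_le_mk.1 h.le) (DistHull.mk_le_mk.1 h.ge))

theorem gen_eq_mk (ξ : Ω) (i : Bool) (n : ℕ) : gen ξ i = DistHull.mk n (FreeDistExt.gen ξ i n) :=
  (DistHull.mk_incl n.zero_le _).symm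

/-- Finiteness of supports is what makes the free set theorem applicable. -/
theorem finite_notMem_avoid (x : GSemilattice Ω) : {ξ | x ∉ avoid ξ}.Finite := by
  obtain ⟨n, x, rfl⟩ := DistHull.exists_eq_mk x
  exact (FreeDistExt.finite_notMem_avoid n x).subset fun ξ hξ hx => hξ ⟨n, x, hx, rfl⟩

/-- Avoiding ξ persists under the inclusions, so several elements with different supports can be
represented at one common level. -/
theorem exists_eq_mk_of_mem_avoid {ξ : Ω} {x : GSemilattice Ω} (hx : x ∈ avoid ξ) :
    ∃ n, ∀ m ≥ n, ∃ y ∈ FreeDistExt.avoid ξ m, x = DistHull.mk m y := by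
  obtain ⟨n, y, hy, rfl⟩ := hx
  exact ⟨n, fun m hm => ⟨_, incl_mem_avoid hm hy, (DistHull.mk_incl hm y).symm⟩⟩

/-- The evaporation lemma. -/
theorem eq_bot_of_le_sup {α β δ : Ω} (hα : δ ≠ α) (hβ : δ ≠ β) {i j k l : Bool}
    {x y z : GSemilattice Ω} (hx : x ∈ avoid β) (hy : y ∈ avoid α) (hz : z ∈ avoid δ)
    (hxd : x ≤ gen δ i) (hxa : x ≤ gen α k) (hyd : y ≤ gen δ j) (hyb : y ≤ gen β l)
    (hzxy : z ≤ x ⊔ y) : z = ⊥ := by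
  obtain ⟨a, ha⟩ := exists_eq_mk_of_mem_avoid hx
  obtain ⟨b, hb⟩ := exists_eq_mk_of_mem_avoid hy
  obtain ⟨c, hc⟩ := exists_eq_mk_of_mem_avoid hz
  obtain ⟨x, hx', rfl⟩ := ha (max a (max b c)) (le_max_left _ _)
  obtain ⟨y, hy', rfl⟩ := hb (max a (max b c)) ((le_max_left _ _).trans (le_max_right _ _))
  obtain ⟨z, hz', rfl⟩ := hc (max a (max b c)) ((le_max_right _ _).trans (le_max_right _ _))
  generalize max a (max b c) = n at *
  rw [gen_eq_mk _ _ n, DistHull.mk_le_mk] at hxd hxa hyd hyb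
  rw [← DistHull.mk_sup, DistHull.mk_le_mk] at hzxy
  rw [← DistHull.mk_bot n]
  exact le_antisymm (DistHull.mk_le_mk.2 (FreeDistExt.evaporates hα hβ i j k l n x hx' y hy' z hz'
    hxd hxa hyd hyb hzxy)) (DistHull.mk_le_mk.2 bot_le)

end

end GSemilattice

/-! ### Joins of congruences -/

namespace LatticeCon

section

variable {L : Type u} [Lattice L]

theorem principal_le_iff {x y : L} {c : LatticeCon L} : principal x y ≤ c ↔ c.r x y :=
  ⟨fun h => le_iff.1 h x y fun _ hd => hd, fun h => sInf_le h⟩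

theorem principal_r (x y : L) : (principal x y).r x y := principal_le_iff.1 le_rfl

theorem r_of_mem_Icc {c : LatticeCon L} {s t x y : L} (h : c.r s t) (hx : x ∈ Set.Icc s t)
    (hy : y ∈ Set.Icc s t) : c.r x y := by
  have key : ∀ w ∈ Set.Icc s t, c.r w t := by
    intro w hw
    have := c.sup h (c.refl w)
    rwa [sup_eq_right.2 hw.1, sup_eq_left.2 hw.2] at this
  exact c.trans (key x hx) (c.symm (key y hy))

/-- The join of two congruences consists of the pairs that are connected by a zigzag. -/
theorem reflTransGen_of_sup_r {c d : LatticeCon L} {x y : L} (h : (c ⊔ d).r x y) :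
    Relation.ReflTransGen (fun a b => c.r a b ∨ d.r a b) x y := by
  have hmap : ∀ f : L → L, (∀ a b, c.r a b ∨ d.r a b → c.r (f a) (f b) ∨ d.r (f a) (f b)) →
      ∀ {a b}, Relation.ReflTransGen (fun a b => c.r a b ∨ d.r a b) a b →
        Relation.ReflTransGen (fun a b => c.r a b ∨ d.r a b) (f a) (f b) :=
    fun f hf _ _ h => Relation.ReflTransGen.lift f hf _ _ h
  let e : LatticeCon L :=
    { r := Relation.ReflTransGen fun a b => c.r a b ∨ d.r a b
      iseqv :=
        { refl := fun _ => Relation.ReflTransGen.refl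
          symm := fun h => by
            induction h with
            | refl => exact Relation.ReflTransGen.refl
            | tail _ h ih => exact Relation.ReflTransGen.head (h.imp c.symm d.symm) ih
          trans := Relation.ReflTransGen.trans }
      -- Zigzags need not have equal length, so one argument is moved at a time.
      inf := fun {w x y z} h k =>
        (hmap (· ⊓ y) (fun a b => Or.imp (fun m => c.inf m (c.refl y))
          (fun m => d.inf m (d.refl y))) h).trans
        (hmap (x ⊓ ·) (fun a b => Or.imp (fun m => c.inf (c.refl x) m)
          (fun m => d.inf (d.refl x) m)) k)
      sup := fun {w x y z} h k =>
        (hmap (· ⊔ y) (fun a b => Or.imp (fun m => c.sup m (c.refl y))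
          (fun m => d.sup m (d.refl y))) h).trans
        (hmap (x ⊔ ·) (fun a b => Or.imp (fun m => c.sup (c.refl x) m)
          (fun m => d.sup (d.refl x) m)) k) }
  have hle : c ⊔ d ≤ e := sup_le (le_iff.2 fun _ _ m => Relation.ReflTransGen.single (Or.inl m))
    (le_iff.2 fun _ _ m => Relation.ReflTransGen.single (Or.inr m))
  exact le_iff.1 hle x y h

/-- Two comparable elements that are congruent modulo a join of two congruences are connected by
an alternating chain inside the interval that they span. -/
theorem exists_chain {c : Bool → LatticeCon L} {s t : L} (hst : s ≤ t)
    (h : (c false ⊔ c true).r s t) :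
    ∃ (n : ℕ) (z : ℕ → L), z 0 = s ∧ z n = t ∧ (∀ i, z i ∈ Set.Icc s t) ∧
      ∀ i < n, (c i.bodd).r (z i) (z (i + 1)) := by
  suffices H : ∃ (n : ℕ) (z : ℕ → L), z 0 = s ∧ z n = t ∧
      ∀ i < n, (c i.bodd).r (z i) (z (i + 1)) by
    obtain ⟨n, z, h0, hn, hz⟩ := H
    -- Clamping to [s, t] preserves all congruences and fixes both ends.
    refine ⟨n, fun i => (z i ⊔ s) ⊓ t, ?_, ?_, fun i => ⟨le_inf le_sup_right hst, inf_le_right⟩,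
      fun i hi => (c i.bodd).inf ((c i.bodd).sup (hz i hi) ((c i.bodd).refl _)) ((c i.bodd).refl _)⟩
    · simp [h0, hst]
    · simp [hn, hst]
  have snoc : ∀ (b : L) (n : ℕ) (z : ℕ → L) (a : L), z 0 = s → z n = a →
      (∀ i < n, (c i.bodd).r (z i) (z (i + 1))) → (c n.bodd).r a b →
      ∃ z' : ℕ → L, z' 0 = s ∧ z' (n + 1) = b ∧
        ∀ i < n + 1, (c i.bodd).r (z' i) (z' (i + 1)) := by
    intro b n z a h0 hn hz hab
    refine ⟨Function.update z (n + 1) b, ?_, by simp, fun i hi => ?_⟩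
    · rw [Function.update_of_ne (by omega), h0]
    · rw [Function.update_of_ne (by omega)]
      rcases Nat.lt_succ_iff_lt_or_eq.1 hi with hi | rfl
      · rw [Function.update_of_ne (by omega)]
        exact hz i hi
      · rw [Function.update_self, hn]
        exact hab
  have := reflTransGen_of_sup_r h
  clear h hst
  induction this with
  | refl => exact ⟨0, fun _ => s, rfl, rfl, fun i hi => absurd hi (Nat.not_lt_zero i)⟩
  | @tail a b _ hab ih =>
    obtain ⟨n, z, h0, hn, hz⟩ := ih
    have hab' : ∃ j, (c j).r a b := hab.elim (fun m => ⟨_, m⟩) (fun m => ⟨_, m⟩)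
    obtain ⟨j, hab'⟩ := hab'
    by_cases hj : n.bodd = j
    · obtain ⟨z', h⟩ := snoc b n z a h0 hn hz (hj ▸ hab')
      exact ⟨n + 1, z', h⟩
    -- If the parity is wrong, a trivial step from `a` to itself corrects it.
    · obtain ⟨z', h0', hn', hz'⟩ := snoc a n z a h0 hn hz ((c n.bodd).refl a)
      have hj' : (n + 1).bodd = j := by
        rw [Nat.bodd_succ]
        cases h : n.bodd <;> cases j <;> simp_all
      obtain ⟨z'', h⟩ := snoc b (n + 1) z' a h0' hn' hz' (hj' ▸ hab')
      exact ⟨n + 2, z'', h⟩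

/-- The erosion lemma. -/
theorem exists_erosion {α : Bool → LatticeCon L} {s t : L} {n : ℕ} {z : ℕ → L} (h0 : z 0 = s)
    (hn : z n = t) (hz : ∀ i, z i ∈ Set.Icc s t)
    (hα : ∀ i < n, (α i.bodd).r (z i) (z (i + 1))) {x : Bool → L}
    (hx : ∀ j, x j ∈ Set.Icc s t) :
    ∃ F : Bool → Finset (L × L),
      (∀ j, ∀ p ∈ F j, (∃ i ≤ n, p.1 = z i ⊔ x j) ∧ ∃ i ≤ n, p.2 = z i ⊔ x j) ∧
      (∀ j, ((F j).sup fun p => principal p.1 p.2) ≤ α j) ∧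
      (∀ j, ((F j).sup fun p => principal p.1 p.2) ≤ principal (x j) t) ∧
      principal (x false ⊔ x true) t ≤
        ((F false).sup fun p => principal p.1 p.2) ⊔ (F true).sup fun p => principal p.1 p.2 := by
  classical
  -- The chain steps of parity `j`, joined with `x j`: each step is in `α j`, and both ends now lie
  -- in [x j, t].
  let F : Bool → Finset (L × L) := fun j =>
    ((Finset.range n).filter fun i => i.bodd = j).image fun i => (z i ⊔ x j, z (i + 1) ⊔ x j)
  have hF : ∀ j p, p ∈ F j → ∃ i < n, i.bodd = j ∧ (z i ⊔ x j, z (i + 1) ⊔ x j) = p := by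
    intro j p hp
    obtain ⟨i, hi, e⟩ := Finset.mem_image.1 hp
    obtain ⟨hi, hj⟩ := Finset.mem_filter.1 hi
    exact ⟨i, Finset.mem_range.1 hi, hj, e⟩
  refine ⟨F, ?_, ?_, ?_, ?_⟩
  · intro j p hp
    obtain ⟨i, hi, -, rfl⟩ := hF j p hp
    exact ⟨⟨i, hi.le, rfl⟩, ⟨i + 1, hi, rfl⟩⟩
  · refine fun j => Finset.sup_le fun p hp => ?_
    obtain ⟨i, hi, rfl, rfl⟩ := hF j p hp
    exact principal_le_iff.2 ((α i.bodd).sup (hα i hi) ((α i.bodd).refl _))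
  · refine fun j => Finset.sup_le fun p hp => ?_
    obtain ⟨i, hi, -, rfl⟩ := hF j p hp
    exact principal_le_iff.2 (r_of_mem_Icc (principal_r _ _)
      ⟨le_sup_right, sup_le (hz _).2 (hx j).2⟩ ⟨le_sup_right, sup_le (hz _).2 (hx j).2⟩)
  · generalize hθ : ((F false).sup fun p => principal p.1 p.2) ⊔
      ((F true).sup fun p => principal p.1 p.2) = θ
    have hle : ∀ j, ((F j).sup fun p => principal p.1 p.2) ≤ θ := by
      intro j
      rw [← hθ]
      cases j
      · exact le_sup_left
      · exact le_sup_right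
    have hstep : ∀ i < n, θ.r (z i ⊔ x i.bodd) (z (i + 1) ⊔ x i.bodd) := by
      intro i hi
      refine principal_le_iff.1 (le_trans ?_ (hle i.bodd))
      have hmem : (z i ⊔ x i.bodd, z (i + 1) ⊔ x i.bodd) ∈ F i.bodd := Finset.mem_image.2
        ⟨i, Finset.mem_filter.2 ⟨Finset.mem_range.2 hi, rfl⟩, rfl⟩
      exact Finset.le_sup (f := fun p : L × L => principal p.1 p.2) hmem
    have habs : ∀ (j : Bool) (w : L), w ⊔ x j ⊔ (x false ⊔ x true) = w ⊔ (x false ⊔ x true) := by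
      intro j w
      rw [sup_assoc]
      congr 1
      refine sup_eq_right.2 ?_
      cases j
      · exact le_sup_left
      · exact le_sup_right
    -- Joining further with `x false ⊔ x true` makes the steps of both parities fit into one chain,
    -- from `x false ⊔ x true` to `t`.
    have hchain : ∀ i ≤ n, θ.r (z 0 ⊔ (x false ⊔ x true)) (z i ⊔ (x false ⊔ x true)) := by
      intro i
      induction i with
      | zero => exact fun _ => θ.refl _
      | succ i ih =>
        intro hi
        have := θ.sup (hstep i hi) (θ.refl (x false ⊔ x true))
        rw [habs, habs] at this
        exact θ.trans (ih (Nat.le_of_succ_le hi)) this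
    have := hchain n le_rfl
    rw [h0, hn, sup_eq_right.2 ((hx false).1.trans le_sup_left),
      sup_eq_left.2 (sup_le (hx false).2 (hx true).2)] at this
    exact principal_le_iff.2 this

/-! ### Compact congruences -/

/-- The union of a nonempty directed family of congruences is itself a congruence. -/
theorem sSup_r_of_directedOn {C : Set (LatticeCon L)} (hne : C.Nonempty)
    (hC : DirectedOn (· ≤ ·) C) {x y : L} (h : (sSup C).r x y) : ∃ c ∈ C, c.r x y := by
  obtain ⟨c₀, hc₀⟩ := hne
  have key : ∀ {w x y z : L}, (∃ c ∈ C, c.r w x) → (∃ c ∈ C, c.r y z) →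
      ∃ c ∈ C, c.r w x ∧ c.r y z := by
    rintro w x y z ⟨c, hc, h⟩ ⟨d, hd, k⟩
    obtain ⟨e, he, hce, hde⟩ := hC c hc d hd
    exact ⟨e, he, le_iff.1 hce _ _ h, le_iff.1 hde _ _ k⟩
  let e : LatticeCon L :=
    { r := fun x y => ∃ c ∈ C, c.r x y
      iseqv :=
        { refl := fun x => ⟨c₀, hc₀, c₀.refl x⟩
          symm := fun ⟨c, hc, h⟩ => ⟨c, hc, c.symm h⟩
          trans := fun h k => by
            obtain ⟨c, hc, h, k⟩ := key h k
            exact ⟨c, hc, c.trans h k⟩ }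
      inf := fun h k => by
        obtain ⟨c, hc, h, k⟩ := key h k
        exact ⟨c, hc, c.inf h k⟩
      sup := fun h k => by
        obtain ⟨c, hc, h, k⟩ := key h k
        exact ⟨c, hc, c.sup h k⟩ }
  have hle : sSup C ≤ e := sSup_le fun c hc => le_iff.2 fun x y h => ⟨c, hc, h⟩
  exact le_iff.1 hle x y h

theorem isCompactElement_principal (x y : L) : IsCompactElement (principal x y) := by
  rw [CompleteLattice.isCompactElement_iff_le_of_directed_sSup_le]
  intro C hne hC h
  obtain ⟨c, hc, hr⟩ := sSup_r_of_directedOn hne hC (principal_le_iff.1 h)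
  exact ⟨c, hc, principal_le_iff.2 hr⟩

/-- A congruence is the join of the principal congruences of its pairs; compactness selects finitely
many of them. -/
theorem isCompactElement_iff_isFinitelyGenerated {c : LatticeCon L} :
    IsCompactElement c ↔ c.IsFinitelyGenerated := by
  classical
  constructor
  · intro h
    obtain ⟨F, hF⟩ := CompleteLattice.IsCompactElement.exists_finset_of_le_iSup _ h
      (fun p : {p : L × L // c.r p.1 p.2} => principal p.1.1 p.1.2)
      (le_iff.2 fun x y hxy => principal_le_iff.1
        (le_iSup (fun p : {p : L × L // c.r p.1 p.2} => principal p.1.1 p.1.2) ⟨(x, y), hxy⟩))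
    refine ⟨F.image Subtype.val, le_antisymm (hF.trans ?_) (Finset.sup_le fun p hp => ?_)⟩
    · exact iSup₂_le fun p hp => Finset.le_sup (f := fun p : L × L => principal p.1 p.2)
        (Finset.mem_image_of_mem _ hp)
    · obtain ⟨q, -, rfl⟩ := Finset.mem_image.1 hp
      exact principal_le_iff.2 q.2
  · rintro ⟨F, rfl⟩
    exact CompleteLattice.isCompactElement_finsetSup F fun p _ => isCompactElement_principal _ _

/-- Every nonempty finite join of principal congruences lies below the principal congruence of a
comparable pair. -/
theorem exists_sup_le_principal {F : Finset (L × L)} (hF : F.Nonempty) :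
    ∃ s t : L, s ≤ t ∧ (F.sup fun p => principal p.1 p.2) ≤ principal s t := by
  refine ⟨F.inf' hF fun p => p.1 ⊓ p.2, F.sup' hF fun p => p.1 ⊔ p.2, ?_, Finset.sup_le ?_⟩
  · obtain ⟨p, hp⟩ := hF
    exact (Finset.inf'_le _ hp).trans (inf_le_sup.trans (Finset.le_sup' (fun p => p.1 ⊔ p.2) hp))
  · intro p hp
    have h1 := Finset.inf'_le (fun p : L × L => p.1 ⊓ p.2) hp
    have h2 := Finset.le_sup' (fun p : L × L => p.1 ⊔ p.2) hp
    exact principal_le_iff.2 (r_of_mem_Icc (principal_r _ _)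
      ⟨h1.trans inf_le_left, le_sup_left.trans h2⟩ ⟨h1.trans inf_le_right, le_sup_right.trans h2⟩)

end

end LatticeCon

/-! ### Kuratowski's free set theorem -/

/-- A subset of cardinality at most `κ` can be enlarged to a subset of cardinality at most `κ` that
is closed under a given finite-set-valued map on finite sets. -/
theorem exists_closed_superset {X : Type u} {κ : Cardinal.{u}} (hκ : ℵ₀ ≤ κ) {Y : Set X}
    (hY : #Y ≤ κ) {Φ : Finset X → Set X} (hΦ : ∀ U, (Φ U).Finite) :
    ∃ Z, Y ⊆ Z ∧ #Z ≤ κ ∧ ∀ U : Finset X, ↑U ⊆ Z → Φ U ⊆ Z := by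
  classical
  -- One round of closing off. After ω rounds, any finite subset already lies in some stage, so its
  -- image lies in the next.
  let f : Set X → Set X := fun A => A ∪ ⋃ U : Finset A, Φ (U.map (Function.Embedding.subtype _))
  have hf : ∀ A : Set X, #A ≤ κ → #(f A) ≤ κ := by
    intro A hA
    have hfin : #(Finset A) ≤ κ := by
      rcases finite_or_infinite A with h | h
      · exact (Cardinal.lt_aleph0_of_finite _).le.trans hκ
      · rwa [Cardinal.mk_finset_of_infinite]
    refine (Cardinal.mk_union_le _ _).trans (Cardinal.add_le_of_le hκ hA ?_)
    refine (Cardinal.mk_iUnion_le _).trans (Cardinal.mul_le_of_le hκ hfin ?_)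
    exact ciSup_le' fun U => (hΦ _).lt_aleph0.le.trans hκ
  let g : ℕ → Set X := fun n => f^[n] Y
  have hg : ∀ n, g (n + 1) = f (g n) := fun n => Function.iterate_succ_apply' f n Y
  have hmono : Monotone g := monotone_nat_of_le_succ fun n => by
    rw [hg]
    exact Set.subset_union_left
  refine ⟨⋃ n, g n, Set.subset_iUnion g 0, ?_, fun U hU => ?_⟩
  · have hcard : ∀ n, #(g n) ≤ κ := by
      intro n
      induction n with
      | zero => exact hY
      | succ n ih =>
        rw [hg]
        exact hf _ ih
    have h := Cardinal.mk_iUnion_le_lift (f := fun n => g n)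
    simp only [Cardinal.mk_nat, Cardinal.lift_aleph0, Cardinal.lift_uzero] at h
    exact h.trans (Cardinal.mul_le_of_le hκ hκ (ciSup_le' fun n => hcard n))
  · obtain ⟨n, hn⟩ := Directed.exists_mem_subset_of_finset_subset_biUnion
      (f := g) hmono.directed_le hU
    refine Set.Subset.trans ?_ (Set.subset_iUnion g (n + 1))
    rw [hg]
    refine Set.Subset.trans ?_ Set.subset_union_right
    refine Set.Subset.trans (Eq.subset ?_) (Set.subset_iUnion _ (U.subtype (· ∈ g n)))
    congr 1
    rw [Finset.subtype_map, Finset.filter_true_of_mem hn]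

/-- Kuratowski's free set theorem: on a set of cardinality at least `ℵ_ m`, every map from finite
sets to finite sets has a free set with `m + 1` elements. -/
theorem exists_free_finset {X : Type u} (m : ℕ) : ∀ Y : Set X, ℵ_ m ≤ #Y →
    ∀ Φ : Finset X → Set X, (∀ U, (Φ U).Finite) →
      ∃ U : Finset X, ↑U ⊆ Y ∧ U.card = m + 1 ∧ ∀ V ⊆ U, V.card = m → ∀ x ∈ U, x ∉ V → x ∉ Φ V := by
  classical
  induction m with
  | zero =>
    intro Y hY Φ hΦ
    have hinf : Y.Infinite := by
      rw [← Set.infinite_coe_iff, Cardinal.infinite_iff]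
      simpa using hY
    obtain ⟨x, hx, hx'⟩ := hinf.exists_notMem_finite (hΦ ∅)
    refine ⟨{x}, by simpa using hx, rfl, fun V _ hV y hy _ => ?_⟩
    rw [Finset.card_eq_zero.1 hV, Finset.mem_singleton.1 hy]
    exact hx'
  | succ m ih =>
    intro Y hY Φ hΦ
    have hlt : ℵ_ (m : Ordinal) < ℵ_ ((m + 1 : ℕ) : Ordinal) :=
      Cardinal.aleph_lt_aleph.2 (by exact_mod_cast Nat.lt_succ_self m)
    obtain ⟨Y₀, hY₀, hcard⟩ := Cardinal.le_mk_iff_exists_subset.1 (hlt.le.trans hY)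
    obtain ⟨Z, hYZ, hZ, hcl⟩ := exists_closed_superset (Cardinal.aleph0_le_aleph _) hcard.le hΦ
    obtain ⟨x, hxY, hxZ⟩ : ∃ x ∈ Y, x ∉ Z := by
      by_contra! h
      exact absurd (hY.trans ((Cardinal.mk_le_mk_of_subset h).trans hZ)) hlt.not_ge
    -- With `x` outside the closed set `Z`, the induction runs inside `Z` with `x` as a fixed extra
    -- argument. Sets `V` containing `x` are then handled by freeness of `U`, and the remaining case
    -- `V = U` by closedness of `Z`.
    obtain ⟨U, hUZ, hU, hfree⟩ := ih (Z ∩ Y) (hcard.ge.trans (Cardinal.mk_le_mk_of_subset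
      (Set.subset_inter hYZ hY₀))) (fun V => Φ (insert x V)) fun V => hΦ _
    have hxU : x ∉ U := fun h => hxZ (hUZ h).1
    refine ⟨insert x U, ?_, by rw [Finset.card_insert_of_notMem hxU, hU], ?_⟩
    · rw [Finset.coe_insert]
      exact Set.insert_subset hxY (hUZ.trans Set.inter_subset_right)
    · intro V hV hVc y hy hyV
      by_cases hxV : x ∈ V
      · have hyU : y ∈ U := (Finset.mem_insert.1 hy).resolve_left fun e => hyV (e ▸ hxV)
        have := hfree (V.erase x) (fun v hv =>
            (Finset.mem_insert.1 (hV (Finset.mem_of_mem_erase hv))).resolve_left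
              (Finset.ne_of_mem_erase hv))
          (by rw [Finset.card_erase_of_mem hxV, hVc]; rfl) y hyU
          (fun h => hyV (Finset.mem_of_mem_erase h))
        rwa [Finset.insert_erase hxV] at this
      · have hVU : V ⊆ U := (Finset.subset_insert_iff_of_notMem hxV).1 hV
        have hVe : V = U := Finset.eq_of_subset_of_card_le hVU (by rw [hU, hVc])
        have hyx : y = x := (Finset.mem_insert.1 hy).resolve_right fun h => hyV (hVe ▸ h)
        subst hyx
        exact fun h => hxZ (hcl V (fun v hv => (hUZ (hVU hv)).1) h)

/-! ### The ideal lattice of a join-semilattice with zero -/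

namespace Order.Ideal

section

variable {P : Type u} [SemilatticeSup P] [OrderBot P]

theorem isCompactElement_principal (x : P) : IsCompactElement (principal x) := by
  intro C u hne hC hu hx
  obtain ⟨I₀, hI₀⟩ := hne
  -- A directed union of ideals is an ideal, so it contains the supremum `u`.
  let J : Ideal P :=
    { carrier := {y | ∃ I ∈ C, y ∈ I}
      lower' := fun a b hba ⟨I, hI, ha⟩ => ⟨I, hI, I.lower hba ha⟩
      nonempty' := ⟨⊥, I₀, hI₀, I₀.bot_mem⟩
      directed' := fun a ⟨I, hI, ha⟩ b ⟨I', hI', hb⟩ => by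
        obtain ⟨K, hK, h, h'⟩ := hC I hI I' hI'
        exact ⟨a ⊔ b, ⟨K, hK, sup_mem (h ha) (h' hb)⟩, le_sup_left, le_sup_right⟩ }
  have huJ : u ≤ J := hu.2 fun I hI y hy => ⟨I, hI, hy⟩
  obtain ⟨I, hI, hxI⟩ := huJ (hx mem_principal_self)
  exact ⟨I, hI, principal_le_iff.2 hxI⟩

theorem eq_sSup_principal (I : Ideal P) : I = sSup (principal '' (I : Set P)) := by
  apply le_antisymm
  · intro x hx
    exact principal_le_iff.1 (le_sSup (Set.mem_image_of_mem _ hx))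
  · refine sSup_le ?_
    rintro _ ⟨x, hx, rfl⟩
    exact principal_le_iff.2 hx

theorem isCompactElement_iff_exists_eq_principal {I : Ideal P} :
    IsCompactElement I ↔ ∃ x, principal x = I := by
  constructor
  · intro h
    rw [CompleteLattice.isCompactElement_iff_le_of_directed_sSup_le] at h
    obtain ⟨_, ⟨x, hx, rfl⟩, hle⟩ := h (principal '' (I : Set P)) (I.nonempty.image _) (by
      rintro _ ⟨x, hx, rfl⟩ _ ⟨y, hy, rfl⟩
      exact ⟨_, ⟨x ⊔ y, sup_mem hx hy, rfl⟩, principal_le_iff.2 (mem_principal.2 le_sup_left),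
        principal_le_iff.2 (mem_principal.2 le_sup_right)⟩) (eq_sSup_principal I).le
    exact ⟨x, le_antisymm (principal_le_iff.2 hx) hle⟩
  · rintro ⟨x, rfl⟩
    exact isCompactElement_principal x

/-- The compact ideals are the principal ideals. -/
noncomputable def principalIso : P ≃o {I : Ideal P // IsCompactElement I} :=
  RelIso.ofSurjective
    (⟨⟨fun x => ⟨principal x, isCompactElement_principal x⟩, fun x y h =>
        le_antisymm (mem_principal.1 (principal_le_iff.1 (congrArg Subtype.val h).le))
          (mem_principal.1 (principal_le_iff.1 (congrArg Subtype.val h).ge))⟩,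
      fun {x y} => principal_le_iff.trans mem_principal⟩ :
      P ↪o {I : Ideal P // IsCompactElement I})
    fun ⟨I, hI⟩ => by
      obtain ⟨x, rfl⟩ := isCompactElement_iff_exists_eq_principal.1 hI
      exact ⟨x, rfl⟩

theorem isCompactlyGenerated : IsCompactlyGenerated (Ideal P) :=
  ⟨fun I => ⟨_, by
    rintro _ ⟨x, -, rfl⟩
    exact isCompactElement_principal x, (eq_sSup_principal I).symm⟩⟩

theorem isCompactElement_top {x : P} (hx : ∀ y, y ≤ x) : IsCompactElement (⊤ : Ideal P) := by
  have : principal x = ⊤ := top_le_iff.1 fun y _ => hx y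
  exact this ▸ isCompactElement_principal x

/-- The ideal lattice of a distributive join-semilattice is distributive. -/
theorem inf_sup_distrib (h : ∀ u v w : P, w ≤ u ⊔ v → ∃ x y, x ≤ u ∧ y ≤ v ∧ x ⊔ y = w)
    (I J K : Ideal P) : I ⊓ (J ⊔ K) = (I ⊓ J) ⊔ (I ⊓ K) := by
  refine le_antisymm (fun w hw => ?_) le_inf_sup
  obtain ⟨hI, hw⟩ := mem_inf.1 hw
  obtain ⟨u, hu, v, hv, hle⟩ := mem_sup.1 hw
  obtain ⟨x, y, hx, hy, rfl⟩ := h u v w hle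
  exact mem_sup.2 ⟨x, mem_inf.2 ⟨I.lower le_sup_left hI, J.lower hx hu⟩, y,
    mem_inf.2 ⟨I.lower le_sup_right hI, K.lower hy hv⟩, le_rfl⟩

end

end Order.Ideal

/-! ### The size of `G(Ω)` -/

section

variable {Ω : Type u} [Infinite Ω]

theorem GenSemilattice.mk_le : #(GenSemilattice Ω) ≤ #Ω := by
  have hΩ : ℵ₀ ≤ #Ω := Cardinal.aleph0_le_mk Ω
  have h1 : #{p : Finset Ω × Finset Ω // Disjoint p.1 p.2} ≤ #Ω :=
    (Cardinal.mk_subtype_le _).trans (by simp [Cardinal.mul_eq_self hΩ])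
  have h2 : #(GenSemilattice Ω) = #{p : Finset Ω × Finset Ω // Disjoint p.1 p.2} + 1 :=
    Cardinal.mk_option
  rw [h2]
  exact Cardinal.add_le_of_le hΩ h1 (Cardinal.one_le_aleph0.trans hΩ)

/-- A reduced set is determined by its triples, so there are no more of them than finite subsets of
S³. -/
theorem FreeDistExt.mk_le {S : Type u} [SemilatticeSup S] {κ : Cardinal.{u}} (hκ : ℵ₀ ≤ κ)
    (hS : #S ≤ κ) : #(FreeDistExt S) ≤ κ := by
  have hinj : Function.Injective fun x : FreeDistExt S => x.carrier := by
    intro x y h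
    have key : ∀ x y : FreeDistExt S, x.carrier = y.carrier → x ≤ y := fun x y h =>
      FreeDistExt.le_iff_below.2 fun t ht => Or.inl (h ▸ ht)
    exact le_antisymm (key x y h) (key y x h.symm)
  refine (Cardinal.mk_le_of_injective hinj).trans ?_
  have h3 : #(S × S × S) ≤ κ := by
    simp only [Cardinal.mk_prod, Cardinal.lift_id]
    exact Cardinal.mul_le_of_le hκ hS (Cardinal.mul_le_of_le hκ hS hS)
  rcases finite_or_infinite (S × S × S) with h | h
  · exact (Cardinal.lt_aleph0_of_finite _).le.trans hκ
  · rwa [Cardinal.mk_finset_of_infinite]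

theorem GSemilattice.mk_eq : #(GSemilattice Ω) = #Ω := by
  have hΩ : ℵ₀ ≤ #Ω := Cardinal.aleph0_le_mk Ω
  apply le_antisymm
  · have hiter : ∀ n, #(FreeDistExt.iter (GenSemilattice Ω) n) ≤ #Ω := by
      intro n
      induction n with
      | zero => exact GenSemilattice.mk_le
      | succ n ih => exact FreeDistExt.mk_le hΩ ih
    have hsurj : Function.Surjective fun p : Σ n : ℕ, FreeDistExt.iter (GenSemilattice Ω) n =>
        DistHull.mk p.1 p.2 := fun x => by
      obtain ⟨n, y, rfl⟩ := DistHull.exists_eq_mk x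
      exact ⟨⟨n, y⟩, rfl⟩
    refine (Cardinal.mk_le_of_surjective hsurj).trans ?_
    rw [Cardinal.mk_sigma]
    refine (Cardinal.sum_le_lift_mk_mul_iSup _).trans ?_
    simp only [Cardinal.mk_nat, Cardinal.lift_aleph0]
    exact Cardinal.mul_le_of_le hΩ hΩ (ciSup_le' hiter)
  · exact Cardinal.mk_le_of_injective GSemilattice.gen_false_injective

end

/-! ### Lattices whose congruence semilattice is `G(Ω)` -/

theorem IsCompactElement.orderIso {α : Type u} {β : Type v} [PartialOrder α] [PartialOrder β]
    {c : α} (h : IsCompactElement c) (f : α ≃o β) : IsCompactElement (f c) := by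
  intro C b hne hC hb hle
  obtain ⟨_, ⟨x, hx, rfl⟩, hcx⟩ := h (f.symm '' C) (f.symm b) (hne.image _) (by
    rintro _ ⟨x, hx, rfl⟩ _ ⟨y, hy, rfl⟩
    obtain ⟨w, hw, h1, h2⟩ := hC x hx y hy
    exact ⟨_, ⟨w, hw, rfl⟩, f.symm.monotone h1, f.symm.monotone h2⟩)
    (f.symm.isLUB_image'.2 hb) (f.le_symm_apply.2 hle)
  exact ⟨x, hx, f.le_symm_apply.1 hcx⟩

namespace LatticeCon

section

variable {L : Type u} [Lattice L]

theorem eq_of_bot_r {x y : L} (h : (⊥ : LatticeCon L).r x y) : x = y := by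
  let e : LatticeCon L :=
    { r := Eq
      iseqv := eq_equivalence
      inf := fun h k => h ▸ k ▸ rfl
      sup := fun h k => h ▸ k ▸ rfl }
  exact le_iff.1 (bot_le : ⊥ ≤ e) x y h

/-- The finitely generated congruence generated by a finite set of pairs. -/
def gen (F : Finset (L × L)) : FGCon L := ⟨F.sup fun p => principal p.1 p.2, F, rfl⟩

/-- A finite set that contains `s`, the first `N` members of the chains `z ξ` with `ξ ∈ V`, and
all joins of its elements. -/
def chainClosure {Ω : Type v} (s : L) (z : Ω → ℕ → L) (N : ℕ) (V : Finset Ω) : Set L :=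
  supClosure (insert s {w | ∃ ξ ∈ V, ∃ i ≤ N, z ξ i = w})

section

variable {Ω : Type v} {s : L} {z : Ω → ℕ → L} {N : ℕ} {V W : Finset Ω}

theorem finite_chainClosure (s : L) (z : Ω → ℕ → L) (N : ℕ) (V : Finset Ω) :
    (chainClosure s z N V).Finite := by
  refine Set.Finite.supClosure (Set.Finite.insert _ ?_)
  have : (⋃ ξ ∈ (V : Set Ω), z ξ '' Set.Iic N).Finite :=
    V.finite_toSet.biUnion fun ξ _ => (Set.finite_Iic N).image _
  refine this.subset ?_
  rintro _ ⟨ξ, hξ, i, hi, rfl⟩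
  exact Set.mem_biUnion hξ (Set.mem_image_of_mem _ hi)

theorem base_mem_chainClosure : s ∈ chainClosure s z N V :=
  subset_supClosure (Set.mem_insert _ _)

theorem chain_mem_chainClosure {ξ : Ω} (hξ : ξ ∈ V) {i : ℕ} (hi : i ≤ N) :
    z ξ i ∈ chainClosure s z N V :=
  subset_supClosure (Set.mem_insert_of_mem _ ⟨ξ, hξ, i, hi, rfl⟩)

theorem sup_mem_chainClosure {a b : L} (ha : a ∈ chainClosure s z N V)
    (hb : b ∈ chainClosure s z N V) : a ⊔ b ∈ chainClosure s z N V :=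
  supClosed_supClosure ha hb

theorem chainClosure_mono (h : V ⊆ W) : chainClosure s z N V ⊆ chainClosure s z N W :=
  supClosure_mono (Set.insert_subset_insert fun _ ⟨ξ, hξ, hi⟩ => ⟨ξ, h hξ, hi⟩)

end

end

end LatticeCon

/-! ### Free families of chains and the contradiction. -/

namespace GSemilattice

open LatticeCon

section

variable {Ω : Type u} {L : Type v} [Lattice L]

/-- `z` is a family of chains from `s` to `t` of length `N`, indexed by a finite set `U`, that
decompose the congruence of `s` and `t` along the generators of `G(Ω)`, and `U` is free with respect
to the supports of the congruences that are generated by these chains. -/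
structure IsFreeChainFamily (e : FGCon L ≃o GSemilattice Ω) (s t : L) (N : ℕ) (U : Finset Ω)
    (z : Ω → ℕ → L) : Prop where
  zero : ∀ ξ ∈ U, z ξ 0 = s
  last : ∀ ξ ∈ U, z ξ N = t
  mem_Icc : ∀ ξ ∈ U, ∀ i, z ξ i ∈ Set.Icc s t
  step : ∀ ξ ∈ U, ∀ i < N, (e.symm (gen ξ i.bodd)).1.r (z ξ i) (z ξ (i + 1))
  free : ∀ V ⊆ U, ∀ x ∈ U, x ∉ V → ∀ F : Finset (L × L),
    (F : Set (L × L)) ⊆ chainClosure s z N V ×ˢ chainClosure s z N V →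
      e (LatticeCon.gen F) ∈ avoid x

variable {e : FGCon L ≃o GSemilattice Ω} {s t : L} {N : ℕ} {U : Finset Ω} {z : Ω → ℕ → L}

/-- Two joins with top value can be lowered by one step of the chains, if they are combined. -/
theorem IsFreeChainFamily.sup_sup_eq (h : IsFreeChainFamily e s t N U z) {W : Finset Ω}
    (hW : W ⊆ U) {α β δ : Ω} (hα : α ∈ U) (hβ : β ∈ U) (hδ : δ ∈ U) (hαβ : α ≠ β) (hδα : δ ≠ α)
    (hδβ : δ ≠ β) (hαW : α ∉ W) (hβW : β ∉ W) (hδW : δ ∉ W) {w : L}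
    (hw : w ∈ chainClosure s z N W) (hws : s ≤ w) {k : ℕ} (hk : k < N)
    (h1 : z α (k + 1) ⊔ w = t) (h2 : z β (k + 1) ⊔ w = t) : (z α k ⊔ w) ⊔ (z β k ⊔ w) = t := by
  classical
  have hwt : w ≤ t := h1 ▸ le_sup_right
  let γ : Bool → Ω := fun j => bif j then β else α
  let x : Bool → L := fun j => z (γ j) k ⊔ w
  have hγ : ∀ j, γ j ∈ U := by rintro (_ | _) <;> assumption
  have hγt : ∀ j, z (γ j) (k + 1) ⊔ w = t := by rintro (_ | _) <;> assumption
  have hx : ∀ j, x j ∈ Set.Icc s t := fun j =>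
    ⟨hws.trans le_sup_right, sup_le (h.mem_Icc _ (hγ j) k).2 hwt⟩
  -- The `k`-th step of the chain of `γ j`, joined with `w`, leads from `x j` to `t`.
  have hxt : ∀ j, principal (x j) t ≤ (e.symm (gen (γ j) k.bodd)).1 := by
    intro j
    have := LatticeCon.sup _ (h.step _ (hγ j) k hk)
      ((e.symm (gen (γ j) k.bodd)).1.refl w)
    rw [hγt] at this
    exact principal_le_iff.2 this
  obtain ⟨F, hF, hFδ, hFx, hle⟩ := exists_erosion (α := fun j => (e.symm (gen δ j)).1)
    (h.zero δ hδ) (h.last δ hδ) (h.mem_Icc δ hδ) (h.step δ hδ) hx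
  have hle_gen : ∀ (F : Finset (L × L)) (ξ : Ω) (i : Bool),
      (F.sup fun p => principal p.1 p.2) ≤ (e.symm (gen ξ i)).1 →
        e (LatticeCon.gen F) ≤ gen ξ i := fun F ξ i hF => (e.le_symm_apply).1 hF
  have hmem : ∀ j, (F j : Set (L × L)) ⊆
      chainClosure s z N (insert (γ j) (insert δ W)) ×ˢ
        chainClosure s z N (insert (γ j) (insert δ W)) := by
    have hV : ∀ j, ∀ i ≤ N, z δ i ⊔ x j ∈ chainClosure s z N (insert (γ j) (insert δ W)) :=
      fun j i hi => sup_mem_chainClosure (chain_mem_chainClosure (by simp) hi)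
        (sup_mem_chainClosure (chain_mem_chainClosure (by simp) hk.le) (chainClosure_mono
          ((Finset.subset_insert _ _).trans (Finset.subset_insert _ _)) hw))
    intro j p hp
    obtain ⟨⟨i, hi, e1⟩, i', hi', e2⟩ := hF j p hp
    exact ⟨e1 ▸ hV j i hi, e2 ▸ hV j i' hi'⟩
  have hsub : ∀ j, insert (γ j) (insert δ W) ⊆ U := fun j =>
    Finset.insert_subset (hγ j) (Finset.insert_subset hδ hW)
  have hz : ((({(x false ⊔ x true, t)} : Finset (L × L)) : Set (L × L))) ⊆
      chainClosure s z N (insert α (insert β W)) ×ˢ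
        chainClosure s z N (insert α (insert β W)) := by
    rw [Finset.coe_singleton, Set.singleton_subset_iff]
    have hw' : w ∈ chainClosure s z N (insert α (insert β W)) := chainClosure_mono
      ((Finset.subset_insert _ _).trans (Finset.subset_insert _ _)) hw
    refine ⟨sup_mem_chainClosure (sup_mem_chainClosure ?_ hw') (sup_mem_chainClosure ?_ hw'), ?_⟩
    · exact chain_mem_chainClosure (by simp [γ]) hk.le
    · exact chain_mem_chainClosure (by simp [γ]) hk.le
    · exact h.last α hα ▸ chain_mem_chainClosure (by simp) le_rfl
  -- Evaporation applies: the eroded congruences are built from the chains in {α, δ} ∪ W and {β, δ}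
  -- ∪ W, hence avoid β and α respectively, while Θ(x false ⊔ x true, t) is built from {α, β} ∪ W
  -- and avoids δ.
  have hbot : e (LatticeCon.gen {(x false ⊔ x true, t)}) = ⊥ := by
    refine eq_bot_of_le_sup (x := e (LatticeCon.gen (F false)))
      (y := e (LatticeCon.gen (F true))) hδα hδβ ?_ ?_ ?_ (hle_gen _ _ _ (hFδ false))
      (hle_gen _ _ _ ((hFx false).trans (hxt false))) (hle_gen _ _ _ (hFδ true))
      (hle_gen _ _ _ ((hFx true).trans (hxt true))) ?_
    · exact h.free _ (hsub false) β hβ (by simp [γ, hαβ.symm, hδβ.symm, hβW]) _ (hmem false)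
    · exact h.free _ (hsub true) α hα (by simp [γ, hαβ, hδα.symm, hαW]) _ (hmem true)
    · exact h.free _ (Finset.insert_subset hα (Finset.insert_subset hβ hW)) δ hδ
        (by simp [hδα, hδβ, hδW]) _ hz
    · rw [← map_sup, e.le_iff_le]
      change Finset.sup {(x false ⊔ x true, t)} (fun p : L × L => principal p.1 p.2) ≤ _
      rw [Finset.sup_singleton]
      exact hle
  rw [map_eq_bot_iff] at hbot
  have hbot' : principal (x false ⊔ x true) t = ⊥ := by
    have := congrArg Subtype.val hbot
    change Finset.sup {(x false ⊔ x true, t)} (fun p : L × L => principal p.1 p.2) = ⊥ at this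
    rwa [Finset.sup_singleton] at this
  exact eq_of_bot_r (principal_le_iff.1 hbot'.le)

/-- At its end a single chain reaches t; each step down is paid for by doubling the number of
chains. At the beginning, 2^N chains have join t although all of them stand at s. -/
theorem IsFreeChainFamily.eq (h : IsFreeChainFamily e s t N U z) (hst : s ≤ t)
    (hU : U.card = 2 ^ N + 1) : s = t := by
  classical
  -- L need not have a least element; in the up-set of `s`, the empty join is `s`.
  let Z : U → ℕ → Set.Ici s := fun ξ i => ⟨z ξ i, (h.mem_Icc ξ.1 ξ.2 i).1⟩
  let t' : Set.Ici s := ⟨t, hst⟩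
  have hmem : ∀ (A : Finset U) (i : ℕ), i ≤ N →
      ((A.sup fun ξ => Z ξ i : Set.Ici s) : L) ∈ chainClosure s z N (A.map (.subtype _)) := by
    intro A i hi
    refine Finset.sup_induction (p := fun w : Set.Ici s => (w : L) ∈ chainClosure s z N _)
      base_mem_chainClosure (fun a ha b hb => sup_mem_chainClosure ha hb) fun ξ hξ => ?_
    exact chain_mem_chainClosure (Finset.mem_map_of_mem (Function.Embedding.subtype _) hξ) hi
  have hlower : ∀ k l, k + l = N → ∀ A : Finset U, A.card = 2 ^ k →
      A.sup (fun ξ => Z ξ l) = t' := by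
    intro k
    induction k with
    | zero =>
      intro l hl A hA
      obtain ⟨ξ, rfl⟩ := Finset.card_eq_one.1 hA
      rw [Finset.sup_singleton]
      obtain rfl : l = N := by omega
      exact Subtype.ext (h.last ξ.1 ξ.2)
    | succ k ih =>
      intro l hl A hA
      -- Of 2^k chains at position l + 1, `r` have been traded for two chains each at position l. To
      -- trade one more, the case `r` is used twice, with α and with β added to `C`, and
      -- `sup_sup_eq` merges the results.
      have key : ∀ r, ∀ B C : Finset U, Disjoint B C → B.card = 2 * r → C.card + r = 2 ^ k →
          (B.sup fun ξ => Z ξ l) ⊔ (C.sup fun ξ => Z ξ (l + 1)) = t' := by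
        intro r
        induction r with
        | zero =>
          intro B C _ hB hC
          rw [Finset.card_eq_zero.1 hB, Finset.sup_empty, bot_sup_eq]
          exact ih (l + 1) (by omega) C hC
        | succ r ihr =>
          intro B C hBC hB hC
          obtain ⟨α, hα⟩ : B.Nonempty := Finset.card_pos.1 (by omega)
          obtain ⟨β, hβ⟩ : (B.erase α).Nonempty :=
            Finset.card_pos.1 (by rw [Finset.card_erase_of_mem hα]; omega)
          -- At most 2^(k+1) ≤ 2^N chains are in use; the extra one in 2^N + 1 leaves a fresh δ for
          -- erosion.
          obtain ⟨δ, hδ⟩ : ∃ δ, δ ∉ B ∪ C := by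
            by_contra! hall
            have h1 : (Finset.univ : Finset U).card ≤ (B ∪ C).card :=
              Finset.card_le_card fun x _ => hall x
            rw [Finset.card_univ, Fintype.card_coe, hU, Finset.card_union_of_disjoint hBC] at h1
            have h2 : 2 ^ (k + 1) ≤ 2 ^ N := Nat.pow_le_pow_right (by norm_num) (by omega)
            rw [pow_succ] at h2
            omega
          set B' := (B.erase α).erase β with hB'
          have hBe : B = insert α (insert β B') := by
            rw [hB', Finset.insert_erase hβ, Finset.insert_erase hα]
          have hαβ : β ≠ α := Finset.ne_of_mem_erase hβ
          have hβB : β ∈ B := Finset.mem_of_mem_erase hβ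
          have hcard : B'.card = 2 * r := by
            rw [hB', Finset.card_erase_of_mem hβ, Finset.card_erase_of_mem hα]
            omega
          have hB'B : B' ⊆ B := (Finset.erase_subset _ _).trans (Finset.erase_subset _ _)
          have hnot : ∀ γ ∈ B, γ ∉ C := fun γ hγ => Finset.disjoint_left.1 hBC hγ
          rw [Finset.mem_union, not_or] at hδ
          have hih : ∀ γ ∈ B, γ ∉ B' → Z γ (l + 1) ⊔ ((B'.sup fun ξ => Z ξ l) ⊔
              (C.sup fun ξ => Z ξ (l + 1))) = t' := by
            intro γ hγ hγB'
            rw [← ihr B' (insert γ C) (Finset.disjoint_insert_right.2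
              ⟨hγB', Finset.disjoint_of_subset_left hB'B hBC⟩) hcard
              (by rw [Finset.card_insert_of_notMem (hnot γ hγ)]; omega), Finset.sup_insert]
            exact sup_left_comm _ _ _
          have hαB' : α ∉ B' := fun m => Finset.notMem_erase α B (Finset.mem_of_mem_erase m)
          have hβB' : β ∉ B' := Finset.notMem_erase _ _
          have hin : ∀ γ : U, γ ∉ B' → γ ∉ C → γ.1 ∉ (B' ∪ C).map (.subtype _) := by
            intro γ h1 h2 m
            obtain ⟨γ', m, e⟩ := Finset.mem_map.1 m
            rw [Function.Embedding.subtype_apply] at e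
            rw [Subtype.ext e] at m
            exact (Finset.mem_union.1 m).elim h1 h2
          have hfin := h.sup_sup_eq (W := (B' ∪ C).map (.subtype _)) (α := α.1) (β := β.1)
            (δ := δ.1) (k := l) (w := ((B'.sup fun ξ => Z ξ l) ⊔
              (C.sup fun ξ => Z ξ (l + 1)) : Set.Ici s))
            (fun x hx => by
              obtain ⟨y, -, rfl⟩ := Finset.mem_map.1 hx
              exact y.2) α.2 β.2 δ.2 (fun e => hαβ (Subtype.ext e).symm)
            (fun e => hδ.1 (Subtype.ext e ▸ hα)) (fun e => hδ.1 (Subtype.ext e ▸ hβB))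
            (hin α hαB' (hnot α hα)) (hin β hβB' (hnot β hβB))
            (hin δ (fun m => hδ.1 (hB'B m)) hδ.2)
            (sup_mem_chainClosure
              (chainClosure_mono (Finset.map_subset_map.2 Finset.subset_union_left)
                (hmem B' l (by omega)))
              (chainClosure_mono (Finset.map_subset_map.2 Finset.subset_union_right)
                (hmem C (l + 1) (by omega))))
            (Subtype.prop _) (by omega) (congrArg Subtype.val (hih α hα hαB'))
            (congrArg Subtype.val (hih β hβB hβB'))
          have hfin' : (Z α l ⊔ ((B'.sup fun ξ => Z ξ l) ⊔ C.sup fun ξ => Z ξ (l + 1))) ⊔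
              (Z β l ⊔ ((B'.sup fun ξ => Z ξ l) ⊔ C.sup fun ξ => Z ξ (l + 1))) = t' :=
            Subtype.ext hfin
          rw [← sup_sup_distrib_right] at hfin'
          rw [hBe, Finset.sup_insert, Finset.sup_insert, ← hfin']
          simp only [sup_assoc]
      have hlt := key (2 ^ k) A ∅ (Finset.disjoint_empty_right _) (by rw [hA, pow_succ]; omega)
        (by simp)
      rwa [Finset.sup_empty, sup_bot_eq] at hlt
  obtain ⟨A, -, hA⟩ := Finset.exists_subset_card_eq (s := (Finset.univ : Finset U)) (n := 2 ^ N)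
    (by rw [Finset.card_univ, Fintype.card_coe, hU]; omega)
  have h0 := hlower N 0 rfl A hA
  have hle : t' ≤ ⊥ := h0 ▸ Finset.sup_le fun ξ _ => (h.zero ξ.1 ξ.2).le
  exact le_antisymm hst hle

/-- The congruence semilattice of a lattice is not isomorphic to `G(Ω)` if `Ω` is large. -/
theorem isEmpty_fgCon_orderIso (hΩ : ℵ_ (ω + 1) ≤ #Ω) : IsEmpty (FGCon L ≃o GSemilattice Ω) := by
  classical
  refine ⟨fun e => ?_⟩
  obtain ⟨F, hF⟩ := (e.symm one).2
  have htop : (e.symm one).1 ≠ ⊥ := by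
    intro h0
    have : e.symm one = ⊥ := Subtype.ext h0
    rw [map_eq_bot_iff] at this
    exact bot_ne_one this.symm
  have hne : F.Nonempty := by
    rw [Finset.nonempty_iff_ne_empty]
    rintro rfl
    exact htop hF
  obtain ⟨s, t, hst, hle⟩ := exists_sup_le_principal hne
  rw [← hF] at hle
  have hchain : ∀ ξ : Ω, ∃ (n : ℕ) (z : ℕ → L), z 0 = s ∧ z n = t ∧ (∀ i, z i ∈ Set.Icc s t) ∧
      ∀ i < n, (e.symm (gen ξ i.bodd)).1.r (z i) (z (i + 1)) := by
    intro ξ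
    refine exists_chain (c := fun j => (e.symm (gen ξ j)).1) hst (principal_le_iff.1 ?_)
    have h1 : principal s t ≤ (e.symm one).1 := by
      have : (⟨principal s t, {(s, t)}, (Finset.sup_singleton ..).symm⟩ : FGCon L) ≤ e.symm one :=
        e.le_symm_apply.2 (le_one _)
      exact this
    have h2 : e.symm one = e.symm (gen ξ false) ⊔ e.symm (gen ξ true) := by
      rw [← map_sup, gen_sup_gen]
    exact h1.trans (congrArg Subtype.val h2).le
  choose n z h0 hn hz hstep using hchain
  -- Regularity of ℵ_{ω+1} matters here: the size of the free set depends on N, which is unknown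
  -- beforehand, so one length must occur at least ℵ_m times for every finite m.
  obtain ⟨⟨N⟩, hN⟩ := Cardinal.infinite_pigeonhole_card (fun ξ => ULift.up.{u} (n ξ))
    (ℵ_ (ω + 1)) hΩ (Cardinal.aleph0_le_aleph _) (by
      rw [(Cardinal.isRegular_aleph_add_one ω).cof_ord, Cardinal.mk_uLift, Cardinal.mk_nat,
        Cardinal.lift_aleph0, Cardinal.aleph0_lt_aleph]
      exact add_pos_of_right zero_lt_one _)
  -- All indices involved in congruences generated by pairs from the closure of the chains in `V`.
  let Φ : Finset Ω → Set Ω := fun V =>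
    ⋃ F ∈ {F : Finset (L × L) | (F : Set (L × L)) ⊆
      chainClosure s z N V ×ˢ chainClosure s z N V}, {ξ | e (LatticeCon.gen F) ∉ avoid ξ}
  have hΦ : ∀ V, (Φ V).Finite := by
    intro V
    have hfin := (finite_chainClosure s z N V).prod (finite_chainClosure s z N V)
    refine Set.Finite.biUnion ((hfin.toFinset.powerset).finite_toSet.subset fun F hF => ?_)
      fun F _ => finite_notMem_avoid _
    rw [Finset.mem_coe, Finset.mem_powerset]
    exact fun p hp => hfin.mem_toFinset.2 (hF hp)
  obtain ⟨U, hUN, hU, hfree⟩ := exists_free_finset (2 ^ N) _ ((Cardinal.aleph_le_aleph.2 (by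
    exact (Ordinal.natCast_lt_omega0 (2 ^ N)).le.trans le_self_add)).trans hN) Φ hΦ
  have hUn : ∀ ξ ∈ U, n ξ = N := fun ξ hξ => congrArg ULift.down (hUN hξ)
  have hfam : IsFreeChainFamily e s t N U z :=
    { zero := fun ξ _ => h0 ξ
      last := fun ξ hξ => hUn ξ hξ ▸ hn ξ
      mem_Icc := fun ξ _ => hz ξ
      step := fun ξ hξ i hi => hstep ξ i ((hUn ξ hξ).symm ▸ hi)
      free := by
        intro V hV x hx hxV F hF
        by_contra hmem
        -- The free set theorem speaks only of subsets with exactly 2^N elements; a smaller `V` is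
        -- enlarged to `U.erase x`.
        refine hfree (U.erase x) (Finset.erase_subset _ _)
          (by rw [Finset.card_erase_of_mem hx, hU]; rfl) x hx (Finset.notMem_erase _ _) ?_
        have hVx : V ⊆ U.erase x := fun v hv =>
          Finset.mem_erase.2 ⟨fun e => hxV (e ▸ hv), hV hv⟩
        exact Set.mem_biUnion (hF.trans (Set.prod_mono (chainClosure_mono hVx)
          (chainClosure_mono hVx))) hmem }
  have heq := hfam.eq hst hU
  subst heq
  exact htop (le_bot_iff.1 (hle.trans (principal_le_iff.2 ((⊥ : LatticeCon L).refl _))))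

/-- The congruence lattice of a lattice is not isomorphic to the ideal lattice of `G(Ω)` if `Ω` is
large. -/
theorem isEmpty_latticeCon_orderIso (hΩ : ℵ_ (ω + 1) ≤ #Ω) :
    IsEmpty (LatticeCon L ≃o Order.Ideal (GSemilattice Ω)) := by
  refine ⟨fun f => (isEmpty_fgCon_orderIso (L := L) hΩ).false ?_⟩
  -- An isomorphism of complete lattices restricts to compact elements: finitely generated
  -- congruences on one side, principal ideals, hence G(Ω), on the other.
  have hf : ∀ c : LatticeCon L, c.IsFinitelyGenerated ↔ IsCompactElement (f c) := fun c => by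
    rw [← isCompactElement_iff_isFinitelyGenerated]
    refine ⟨fun h => h.orderIso f, fun h => ?_⟩
    have := h.orderIso f.symm
    rwa [f.symm_apply_apply] at this
  let g : FGCon L ≃o {I : Order.Ideal (GSemilattice Ω) // IsCompactElement I} :=
    { toEquiv := f.toEquiv.subtypeEquiv hf
      map_rel_iff' := f.le_iff_le }
  exact g.trans Order.Ideal.principalIso.symm

end

end GSemilattice

theorem corollary7p2 :
    (∀ Ω : Type u, ℵ_ (ω + 1) ≤ #Ω →
      (∀ (L : Type v) [Lattice L], IsEmpty (FGCon L ≃o GSemilattice Ω)) ∧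
      IsAlgebraicDistributive (Order.Ideal (GSemilattice Ω)) ∧
      IsCompactElement (⊤ : Order.Ideal (GSemilattice Ω)) ∧
      #{I : Order.Ideal (GSemilattice Ω) // IsCompactElement I} = #Ω ∧
      (∀ (L : Type v) [Lattice L], IsEmpty (LatticeCon L ≃o Order.Ideal (GSemilattice Ω)))) ∧
    (∃ (D : Type u) (_ : CompleteLattice D), IsAlgebraicDistributive D ∧
      IsCompactElement (⊤ : D) ∧ #{a : D // IsCompactElement a} = ℵ_ (ω + 1) ∧
      ∀ (L : Type v) [Lattice L], IsEmpty (LatticeCon L ≃o D)) := by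
  have main : ∀ Ω : Type u, ℵ_ (ω + 1) ≤ #Ω →
      (∀ (L : Type v) [Lattice L], IsEmpty (FGCon L ≃o GSemilattice Ω)) ∧
      IsAlgebraicDistributive (Order.Ideal (GSemilattice Ω)) ∧
      IsCompactElement (⊤ : Order.Ideal (GSemilattice Ω)) ∧
      #{I : Order.Ideal (GSemilattice Ω) // IsCompactElement I} = #Ω ∧
      (∀ (L : Type v) [Lattice L],
        IsEmpty (LatticeCon L ≃o Order.Ideal (GSemilattice Ω))) := by
    intro Ω hΩ
    have hinf : Infinite Ω := Cardinal.infinite_iff.2 ((Cardinal.aleph0_le_aleph _).trans hΩ)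
    refine ⟨fun L _ => GSemilattice.isEmpty_fgCon_orderIso hΩ,
      ⟨Order.Ideal.isCompactlyGenerated,
        Order.Ideal.inf_sup_distrib fun _ _ _ => DistHull.exists_split⟩,
      Order.Ideal.isCompactElement_top GSemilattice.le_one, ?_,
      fun L _ => GSemilattice.isEmpty_latticeCon_orderIso hΩ⟩
    rw [← Cardinal.mk_congr Order.Ideal.principalIso.toEquiv, GSemilattice.mk_eq]
  refine ⟨main, ?_⟩
  obtain ⟨-, h1, h2, h3, h4⟩ := main (ℵ_ (ω + 1)).out (Cardinal.mk_out _).ge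
  exact ⟨_, _, h1, h2, h3.trans (Cardinal.mk_out _), h4⟩
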